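/- Let $B$ be an indefinite quaternion algebra over $\mathbb Q$, with a fixed isomorphism $B\otimes_{\mathbb Q}\mathbb R\simeq M_2(\mathbb R)$, and let $V=\{x\in B\mid \mathrm{tr}(x)=0\}$ be its space of elements of reduced trace zero, with the quadratic form $Q(x)=-x^2=\nu(x)$ of signature $(1,2)$ and the bilinear form $(x,y)=-\mathrm{tr}(xy)$, so that $(x,x)=2Q(x)$. Let $$D=\{w\in V(\mathbb C)\mid (w,w)=0,\ (w,\bar w)<0\}/\mathbb C^\times\simeq\mathbb P^1(\mathbb C)\setminus\mathbb P^1(\mathbb R).$$ For $x\in V(\mathbb R)$ and $z\in D$ represented by $w$, put $R(x,z)=|(x,w)|^2\,|(w,\bar w)|^{-1}$ and $$\xi(x)(z)=\beta_1(2\pi R(x,z)),\qquad \beta_1(r)=\int_1^\infty e^{-ru}u^{-1}\,du,$$ and let $D_x=\{z\in D\mid (x,z)=0\}$. Let $\omega(x)$ be the smooth $(1,1)$-form on $D$ that equals $dd^c\xi(x)=-\frac1{2\pi i}\partial\bar\partial\,\xi(x)$ off $D_x$. For a pair $\mathbf x=[x_1,x_2]\in V(\mathbb R)^2$ (for example in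 $V(\mathbb Q)^2$) with nonsingular matrix of inner products $Q(\mathbf x)=\frac12\big((x_i,x_j)\big)$, let $$\Lambda(\mathbf x)=\int_D\xi(x_1)*\xi(x_2)=\sum_{z\in D_{x_2}}\xi(x_1)(z)+\int_D\xi(x_2)\,\omega(x_1)$$ be the integral of the $*$-product $\xi(x_1)*\xi(x_2)=\xi(x_1)\,\delta_{D_{x_2}}+\omega(x_1)\,\xi(x_2)$. Then for every such $\mathbf x$ and every $k\in O(2)$ the quantities $\Lambda(\mathbf x)$ and $\Lambda(\mathbf x\cdot k)$ are well defined (the sets $D_{x_1}$, $D_{x_2}$ are finite and disjoint and the integral over $D$ converges absolutely, and likewise for $\mathbf x\cdot k$), where $(\mathbf x\cdot k)_j=\sum_i k_{ij}x_i$, and $$\Lambda(\mathbf x\cdot k)=\Lambda(\mathbf x).$$ -/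

import Mathlib

open MeasureTheory Matrix
open scoped TensorProduct LinearAlgebra.Projectivization

noncomputable section

namespace Shimura

/-- The space of trace zero `2 × 2` matrices over `F`.  For an indefinite quaternion algebra `B`
over `ℚ` with a fixed identification `B ⊗ ℝ = M₂(ℝ)` these are `V(ℝ)` (for `F = ℝ`) and `V(ℂ)`
(for `F = ℂ`), where `V ⊆ B` is the space of elements of reduced trace zero. -/
def TraceZero (F : Type) [Field F] : Submodule F (Matrix (Fin 2) (Fin 2) F) :=
  LinearMap.ker (Matrix.traceLinearMap (Fin 2) F F)

lemma mem_traceZero {F : Type} [Field F] (x : Matrix (Fin 2) (Fin 2) F) :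
    x ∈ TraceZero F ↔ x.trace = 0 := by
  simp [TraceZero]

/-- The bilinear form `(x, y) = -tr (x y)` attached to the quadratic form
`Q x = -x² = ν x`, normalised by `(x, x) = 2 Q x`. -/
def pair {F : Type} [Field F] (x y : TraceZero F) : F :=
  -((x : Matrix (Fin 2) (Fin 2) F) * (y : Matrix (Fin 2) (Fin 2) F)).trace

/-- `Q x = ½ (x, x)` is the reduced norm, and `-x²` is the scalar `Q x`. -/
lemma half_pair_self (x : TraceZero ℝ) :
    pair x x / 2 = (x : Matrix (Fin 2) (Fin 2) ℝ).det ∧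
      -((x : Matrix (Fin 2) (Fin 2) ℝ) * (x : Matrix (Fin 2) (Fin 2) ℝ))
        = (pair x x / 2) • (1 : Matrix (Fin 2) (Fin 2) ℝ) := by
  obtain ⟨x, hx⟩ := x
  rw [mem_traceZero, Matrix.trace_fin_two] at hx
  have h : x 1 1 = -x 0 0 := by linarith
  constructor
  · simp [pair, Matrix.trace_fin_two, Matrix.mul_apply, Fin.sum_univ_two, Matrix.det_fin_two, h]
    ring
  · ext i j
    fin_cases i <;> fin_cases j <;>
      simp [pair, Matrix.trace_fin_two, Matrix.mul_apply, Fin.sum_univ_two, h] <;> ring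

/-- The inclusion `V(ℝ) ⊆ V(ℂ)`. -/
def toComplex (x : TraceZero ℝ) : TraceZero ℂ :=
  ⟨(x : Matrix (Fin 2) (Fin 2) ℝ).map (fun a => (a : ℂ)), by
    have h := (mem_traceZero _).1 x.2
    rw [Matrix.trace_fin_two] at h
    rw [mem_traceZero, Matrix.trace_fin_two]
    simp only [Matrix.map_apply]
    exact_mod_cast h⟩

/-- Complex conjugation `w ↦ w̄` on `V(ℂ)`. -/
def conj (w : TraceZero ℂ) : TraceZero ℂ :=
  ⟨(w : Matrix (Fin 2) (Fin 2) ℂ).map (starRingEnd ℂ), by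
    have h := (mem_traceZero _).1 w.2
    rw [Matrix.trace_fin_two] at h
    rw [mem_traceZero, Matrix.trace_fin_two]
    simp only [Matrix.map_apply]
    rw [← map_add, h, map_zero]⟩

/-- The symmetric space `D = {w ∈ V(ℂ) | (w, w) = 0, (w, w̄) < 0} / ℂˣ`; the number `(w, w̄)` is
always real. -/
def D : Set (ℙ ℂ (TraceZero ℂ)) :=
  {p | ∃ (w : TraceZero ℂ) (hw : w ≠ 0), p = Projectivization.mk ℂ w hw ∧
    pair w w = 0 ∧ (pair w (conj w)).re < 0}

/-- `R(x, z) = |(x, w)|² |(w, w̄)|⁻¹`, for any vector `w` representing `z`. -/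
def R (x : TraceZero ℝ) (z : ℙ ℂ (TraceZero ℂ)) : ℝ :=
  ‖pair (toComplex x) z.rep‖ ^ 2 * ‖pair z.rep (conj z.rep)‖⁻¹

lemma pair_smul_right {F : Type} [Field F] (c : F) (x y : TraceZero F) :
    pair x (c • y) = c * pair x y := by
  simp [pair, Matrix.trace_smul]

lemma pair_smul_left {F : Type} [Field F] (c : F) (x y : TraceZero F) :
    pair (c • x) y = c * pair x y := by
  simp [pair, Matrix.trace_smul]

lemma conj_smul (c : ℂ) (w : TraceZero ℂ) : conj (c • w) = (starRingEnd ℂ c) • conj w := by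
  apply Subtype.ext
  ext i j
  simp [conj]

/-- `R(x, z)` does not depend on the representative. -/
lemma R_mk (x : TraceZero ℝ) (w : TraceZero ℂ) (hw : w ≠ 0) :
    R x (Projectivization.mk ℂ w hw)
      = ‖pair (toComplex x) w‖ ^ 2 * ‖pair w (conj w)‖⁻¹ := by
  obtain ⟨c, hc⟩ := Projectivization.exists_smul_eq_mk_rep ℂ w hw
  have hc' : (c : ℂ) • w = (Projectivization.mk ℂ w hw).rep := hc
  have h0 : ‖(c : ℂ)‖ ≠ 0 := norm_ne_zero_iff.2 c.ne_zero
  rw [R, ← hc', conj_smul, pair_smul_right, pair_smul_right, pair_smul_left]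
  simp only [norm_mul, RCLike.norm_conj, mul_inv]
  field_simp

/-- The exponential integral `β₁(r) = ∫₁^∞ e^{-ru} u⁻¹ du`, for `r > 0`. -/
def beta1 (r : ℝ) : ℝ := ∫ u in Set.Ioi (1 : ℝ), Real.exp (-r * u) * u⁻¹

/-- The Green function `ξ(x, z) = β₁(2π R(x, z))`. -/
def xi (x : TraceZero ℝ) (z : ℙ ℂ (TraceZero ℂ)) : ℝ := beta1 (2 * Real.pi * R x z)

/-- The divisor `D_x = {z ∈ D | (x, z) = 0}`; all its points have multiplicity one. -/
def divisor (x : TraceZero ℝ) : Set (ℙ ℂ (TraceZero ℂ)) :=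
  {z | z ∈ D ∧ pair (toComplex x) z.rep = 0}

/-- The vector `w(z) = [[z, -z²], [1, -z]]` of `V(ℂ)`. -/
def vec (z : ℂ) : TraceZero ℂ :=
  ⟨!![z, -z ^ 2; 1, -z], by simp [mem_traceZero, Matrix.trace_fin_two]⟩

lemma vec_ne_zero (z : ℂ) : vec z ≠ 0 := by
  intro h
  have := congrFun (congrFun (congrArg Subtype.val h) 1) 0
  simp [vec] at this

/-- The global holomorphic coordinate `ℂ ∖ ℝ = ℙ¹(ℂ) ∖ ℙ¹(ℝ) ≃ D`, sending `z` to the line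
spanned by `w(z)`. -/
def point (z : ℂ) : ℙ ℂ (TraceZero ℂ) := Projectivization.mk ℂ (vec z) (vec_ne_zero z)

/-- `ℂ ∖ ℝ`, the range of the coordinate on `D`. -/
def nonreal : Set ℂ := {z | z.im ≠ 0}

lemma pair_vec_self (z : ℂ) : pair (vec z) (vec z) = 0 := by
  simp [pair, vec, Matrix.trace_fin_two]
  ring

lemma pair_vec_conj (z : ℂ) : pair (vec z) (conj (vec z)) = ((-4 * z.im ^ 2 : ℝ) : ℂ) := by
  simp only [pair, vec, conj, Matrix.trace_fin_two, Matrix.mul_apply, Fin.sum_univ_two]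
  apply Complex.ext <;> simp [pow_two] <;> ring

/-- The coordinate is a bijection from `ℂ ∖ ℝ` onto `D`. -/
lemma point_bijOn : Set.BijOn point nonreal D := by
  refine ⟨?_, ?_, ?_⟩
  · intro z hz
    refine ⟨vec z, vec_ne_zero z, rfl, pair_vec_self z, ?_⟩
    rw [pair_vec_conj, Complex.ofReal_re]
    have : 0 < z.im ^ 2 := by
      have := hz
      simp only [nonreal, Set.mem_ofPred_eq] at this
      positivity
    linarith
  · intro z _ z' _ h
    obtain ⟨a, ha⟩ := (Projectivization.mk_eq_mk_iff' ℂ _ _ _ _).1 h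
    have h10 := congrFun (congrFun (congrArg Subtype.val ha) 1) 0
    have h00 := congrFun (congrFun (congrArg Subtype.val ha) 0) 0
    simp [vec] at h10 h00
    rw [h10] at h00
    simpa using h00.symm
  · rintro p ⟨w, hw, rfl, h0, hneg⟩
    obtain ⟨m, hm⟩ := w
    have htr := (mem_traceZero _).1 hm
    rw [Matrix.trace_fin_two] at htr
    have h11 : m 1 1 = -m 0 0 := by linear_combination htr
    have hq : m 0 0 ^ 2 + m 0 1 * m 1 0 = 0 := by
      simp only [pair, Matrix.trace_fin_two, Matrix.mul_apply, Fin.sum_univ_two, h11] at h0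
      linear_combination (-1 / 2 : ℂ) * h0
    have hc : m 1 0 ≠ 0 := by
      intro hc
      have ha : m 0 0 = 0 := by simpa [hc] using hq
      simp [pair, conj, Matrix.trace_fin_two, Matrix.mul_apply, Fin.sum_univ_two, h11, ha, hc]
        at hneg
    have hmz : (⟨m, hm⟩ : TraceZero ℂ) = m 1 0 • vec (m 0 0 / m 1 0) := by
      apply Subtype.ext
      ext i j
      fin_cases i <;> fin_cases j <;> simp [vec]
      · field_simp
      · field_simp
        linear_combination hq
      · rw [h11]
        field_simp
    refine ⟨m 0 0 / m 1 0, ?_, ?_⟩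
    · intro him
      rw [hmz, conj_smul, pair_smul_left, pair_smul_right, pair_vec_conj, him] at hneg
      simp at hneg
    · exact ((Projectivization.mk_eq_mk_iff' ℂ _ _ _ _).2 ⟨m 1 0, hmz.symm⟩).symm

open InnerProductSpace Laplacian in
/-- For a real function `g` on `D`, the density with respect to Lebesgue measure `dx dy`, in the
coordinate `z = x + iy`, of the `(1,1)`-form `dd^c g = -(2πi)⁻¹ ∂∂̄ g = (4π)⁻¹ Δg dx dy`. -/
def ddc (g : ℙ ℂ (TraceZero ℂ) → ℝ) (z : ℂ) : ℝ :=
  (4 * Real.pi)⁻¹ * (Δ (fun ζ : ℂ => g (point ζ))) z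

/-- The `*`-product `ξ(x₁) * ξ(x₂) = ξ(x₁) δ_{D_{x₂}} + ω(x₁) ξ(x₂)`, as a functional on functions
`f` on `D`.  Here `ω(x₁)` is the smooth form with `dd^c ξ(x₁) + δ_{D_{x₁}} = ω(x₁)`; it is
equal to `dd^c ξ(x₁)` off the finite set `D_{x₁}`, hence almost everywhere. -/
def starProduct (x₁ x₂ : TraceZero ℝ) (f : ℙ ℂ (TraceZero ℂ) → ℝ) : ℝ :=
  (∑ᶠ p ∈ divisor x₂, f p * xi x₁ p) +
    ∫ z in nonreal, f (point z) * (xi x₂ (point z) * ddc (xi x₁) z)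

/-- The integral over `D` of the `*`-product converges: the divisors are finite and disjoint
(so that the values of `ξ(x₁)` on `D_{x₂}` are finite), and `ω(x₁) ξ(x₂)` is absolutely
integrable over `D`. -/
def StarIntegrable (x₁ x₂ : TraceZero ℝ) : Prop :=
  (divisor x₁).Finite ∧ (divisor x₂).Finite ∧ Disjoint (divisor x₁) (divisor x₂) ∧
    IntegrableOn (fun z => xi x₂ (point z) * ddc (xi x₁) z) nonreal

/-- The integral `∫_D ξ(x₁) * ξ(x₂)`. -/
def starIntegral (x₁ x₂ : TraceZero ℝ) : ℝ := starProduct x₁ x₂ (fun _ => 1)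

section Quaternion

variable {B : Type*} [Ring B] [Algebra ℚ B]

/-- `V(ℝ) = V ⊗ ℝ`, the elements of reduced trace zero in `B ⊗ ℝ`, where `φ` identifies
`B ⊗ ℝ` with `M₂(ℝ)`.  It contains `V(ℚ) = V`, as the elements `1 ⊗ x` of it. -/
def VReal (φ : (ℝ ⊗[ℚ] B) ≃ₐ[ℝ] Matrix (Fin 2) (Fin 2) ℝ) : Submodule ℝ (ℝ ⊗[ℚ] B) :=
  (TraceZero ℝ).comap φ.toLinearMap

/-- The identification of `V(ℝ)` with the trace zero matrices given by `φ`. -/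
def toMat (φ : (ℝ ⊗[ℚ] B) ≃ₐ[ℝ] Matrix (Fin 2) (Fin 2) ℝ) (x : VReal φ) : TraceZero ℝ :=
  ⟨φ x, x.2⟩

/-- The matrix of inner products `Q(𝐱) = ½ ((xᵢ, xⱼ))`. -/
def gram (φ : (ℝ ⊗[ℚ] B) ≃ₐ[ℝ] Matrix (Fin 2) (Fin 2) ℝ) (x : Fin 2 → VReal φ) :
    Matrix (Fin 2) (Fin 2) ℝ :=
  Matrix.of fun i j => (1 / 2 : ℝ) * pair (toMat φ (x i)) (toMat φ (x j))

/-- The right action of `2 × 2` matrices on pairs: `(𝐱 k)ⱼ = ∑ᵢ kᵢⱼ xᵢ`. -/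
def rightAct {φ : (ℝ ⊗[ℚ] B) ≃ₐ[ℝ] Matrix (Fin 2) (Fin 2) ℝ} (x : Fin 2 → VReal φ)
    (k : Matrix (Fin 2) (Fin 2) ℝ) : Fin 2 → VReal φ :=
  fun j => ∑ i, k i j • x i

/-- The integral defining `Λ(𝐱)` converges. -/
def LambdaConverges (φ : (ℝ ⊗[ℚ] B) ≃ₐ[ℝ] Matrix (Fin 2) (Fin 2) ℝ) (x : Fin 2 → VReal φ) :
    Prop :=
  StarIntegrable (toMat φ (x 0)) (toMat φ (x 1))

/-- `Λ(𝐱) = ∫_D ξ(x₁) * ξ(x₂)`. -/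
def Lambda (φ : (ℝ ⊗[ℚ] B) ≃ₐ[ℝ] Matrix (Fin 2) (Fin 2) ℝ) (x : Fin 2 → VReal φ) : ℝ :=
  starIntegral (toMat φ (x 0)) (toMat φ (x 1))

end Quaternion

end Shimura

end

noncomputable section

namespace Shimura

open Filter Topology

/-! The star product is not visibly symmetric in its two arguments, but it is the limit of integrals
whose integrand depends on the pair only through `R(x₁,z) + R(x₂,z)` and `Q(x₁) + Q(x₂)`. Both sums
are traces of quadratic forms over the pair, so they do not change under `O(2)`, and neither does
the limit.

Write `g_x(s) = exp(-2πsR(x,·))`, so that `ξ(√t x) = ∫_t^∞ g_x(s) ds/s`. The density `ω(√t x)` then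
satisfies `∂ₜ ω(√t x) = -t⁻¹ dd^c g_x(t)` (`hasDerivAt_omega`). Green's formula for two such
Gaussians (`integral_green`) is integrated against `ds/s dt/t` over the triangle `1 ≤ s ≤ t ≤ T`.
With `ξ_T(x) = ∫_1^T g_x(s) ds/s`, the fundamental theorem of calculus in both parameters gives `∫
ξ_T(y) ω(x) + ∫ ξ_T(x) ω(√T y) = ∫ ∫_1^T symKernel dt` (`integral_truncXi_add`).

As `T → ∞` the first term tends to `∫ ξ(y) ω(x)` by dominated convergence. In the second, `ω(√T y)`
concentrates as a unit mass at each point of `D_y`, so the term tends to the sum of `ξ(x)` over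
`D_y` (`tendsto_integral_truncXi_mul_omega`). The left side thus tends to the star product, and
`starIntegral_congr` and `starIntegral_orthogonal` conclude.

All convergence rests on one estimate. If the Gram determinant is nonzero, the quadratic polynomials
attached to `x` and `y` have nonzero resultant. Hence `R(x,z) + R(y,z)` is bounded below by a
multiple of `gauge z = (1+|z|²)²/(Im z)²` (`gauge_le_height_add`), which blows up at the whole
boundary of `D`, and products of Gaussians decay there faster than any power of the gauge. The only
other singularities are those of `ξ` on its divisor, and they are dominated by simple poles, which
are integrable in the plane. -/

/-! ### Heights in the coordinate on `D`. -/

/-- The reduced norm `½ (x, x)` of a trace zero matrix. -/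
def qnorm (x : TraceZero ℝ) : ℝ := pair x x / 2

/-- The function `z ↦ R(x, z)` in the coordinate of `D`. -/
def height (x : TraceZero ℝ) (z : ℂ) : ℝ := R x (point z)

/-- The quadratic polynomial `(x, w(z))`. -/
def quad (x : TraceZero ℝ) (z : ℂ) : ℂ :=
  (x.1 1 0 : ℂ) * z ^ 2 - 2 * (x.1 0 0 : ℂ) * z - (x.1 0 1 : ℂ)

/-- An explicit rational expression for `height`. -/
def rho (x : TraceZero ℝ) (u v : ℝ) : ℝ :=
  ((x.1 1 0 * (u ^ 2 - v ^ 2) - 2 * x.1 0 0 * u - x.1 0 1) ^ 2 +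
    (2 * x.1 1 0 * u * v - 2 * x.1 0 0 * v) ^ 2) / (4 * v ^ 2)

lemma entry_one_one (x : TraceZero ℝ) : x.1 1 1 = -x.1 0 0 := by
  have h := (mem_traceZero _).1 x.2
  rw [Matrix.trace_fin_two] at h
  linarith

lemma qnorm_eq (x : TraceZero ℝ) : qnorm x = -x.1 0 0 ^ 2 - x.1 0 1 * x.1 1 0 := by
  simp only [qnorm, pair, Matrix.trace_fin_two, Matrix.mul_apply, Fin.sum_univ_two, entry_one_one]
  ring

lemma pair_eq (x y : TraceZero ℝ) :
    pair x y = -(2 * x.1 0 0 * y.1 0 0 + x.1 0 1 * y.1 1 0 + x.1 1 0 * y.1 0 1) := by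
  simp only [pair, Matrix.trace_fin_two, Matrix.mul_apply, Fin.sum_univ_two, entry_one_one]
  ring

lemma pair_toComplex_vec (x : TraceZero ℝ) (z : ℂ) : pair (toComplex x) (vec z) = quad x z := by
  simp only [pair, toComplex, vec, quad, Matrix.trace_fin_two, Matrix.mul_apply, Fin.sum_univ_two,
    Matrix.map_apply, entry_one_one]
  simp
  ring

lemma height_eq_norm (x : TraceZero ℝ) (z : ℂ) :
    height x z = ‖quad x z‖ ^ 2 / (4 * z.im ^ 2) := by
  rw [height, point, R_mk, pair_toComplex_vec, pair_vec_conj, Complex.norm_real, Real.norm_eq_abs,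
    div_eq_mul_inv, abs_of_nonpos (by nlinarith [sq_nonneg z.im])]
  ring_nf

lemma height_eq_rho (x : TraceZero ℝ) (z : ℂ) : height x z = rho x z.re z.im := by
  rw [height_eq_norm, rho, ← Complex.normSq_eq_norm_sq, Complex.normSq_apply, quad]
  simp [pow_two]
  ring_nf

lemma height_nonneg (x : TraceZero ℝ) (z : ℂ) : 0 ≤ height x z := by
  rw [height_eq_norm]; positivity

lemma measurable_height (x : TraceZero ℝ) : Measurable (height x) := by
  have : height x = fun z => ‖quad x z‖ ^ 2 / (4 * z.im ^ 2) := funext (height_eq_norm x)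
  rw [this]
  unfold quad
  fun_prop

lemma continuousAt_height (x : TraceZero ℝ) {z : ℂ} (hz : z.im ≠ 0) :
    ContinuousAt (height x) z := by
  have : height x = fun z => ‖quad x z‖ ^ 2 / (4 * z.im ^ 2) := funext (height_eq_norm x)
  rw [this]
  unfold quad
  have h : (4 * z.im ^ 2) ≠ 0 := by positivity
  refine ContinuousAt.div (by fun_prop) (by fun_prop) h

/-- A point of `D` splits `V(ℝ)` into a negative plane and a positive line. `R` is minus the norm of
the plane component, so `R + Q` is the square of the component on the line. -/
lemma height_add_qnorm (x : TraceZero ℝ) {z : ℂ} (hz : z.im ≠ 0) :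
    height x z + qnorm x =
      ((x.1 1 0 * (z.re ^ 2 + z.im ^ 2) - 2 * x.1 0 0 * z.re - x.1 0 1) / (2 * z.im)) ^ 2 := by
  rw [height_eq_rho, rho, qnorm_eq]
  field_simp
  ring

lemma height_add_qnorm_nonneg (x : TraceZero ℝ) {z : ℂ} (hz : z.im ≠ 0) :
    0 ≤ height x z + qnorm x := by
  rw [height_add_qnorm x hz]; positivity

lemma height_pos_iff (x : TraceZero ℝ) {z : ℂ} (hz : z.im ≠ 0) :
    0 < height x z ↔ quad x z ≠ 0 := by
  rw [height_eq_norm]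
  constructor
  · rintro h h0
    simp [h0] at h
  · intro h
    have := norm_pos_iff.2 h
    positivity

/-! ### The gauge, and Gaussian decay from nondegeneracy. -/

/-- A function comparable to the sum of the heights of two vectors spanning a nondegenerate
plane. -/
def gauge (z : ℂ) : ℝ := (1 + ‖z‖ ^ 2) ^ 2 / z.im ^ 2

lemma im_sq_le (z : ℂ) : z.im ^ 2 ≤ ‖z‖ ^ 2 := by
  rw [← Complex.normSq_eq_norm_sq, Complex.normSq_apply]; nlinarith [sq_nonneg z.re]

lemma four_le_gauge {z : ℂ} (hz : z.im ≠ 0) : 4 ≤ gauge z := by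
  have h : 0 < z.im ^ 2 := by positivity
  rw [gauge, le_div_iff₀ h]
  nlinarith [im_sq_le z, sq_nonneg (1 - ‖z‖ ^ 2)]

/-- Together with `norm_sq_le_gauge` this makes the gauge large both near the real axis and near
infinity. -/
lemma inv_sq_le_gauge {z : ℂ} (hz : z.im ≠ 0) : (z.im ^ 2)⁻¹ ≤ gauge z := by
  have h : 0 < z.im ^ 2 := by positivity
  rw [gauge, inv_eq_one_div]
  gcongr
  nlinarith [sq_nonneg ‖z‖]

lemma norm_sq_le_gauge {z : ℂ} (hz : z.im ≠ 0) : ‖z‖ ^ 2 ≤ gauge z := by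
  have h : 0 < z.im ^ 2 := by positivity
  rw [gauge, le_div_iff₀ h]
  nlinarith [im_sq_le z, sq_nonneg ‖z‖]

/-- The height is dominated by the gauge. -/
lemma height_le_gauge (x : TraceZero ℝ) : ∃ C, 0 < C ∧ ∀ z, height x z ≤ C * gauge z := by
  set K := |x.1 1 0| + 2 * |x.1 0 0| + |x.1 0 1| + 1 with hK
  refine ⟨K ^ 2, by positivity, fun z => ?_⟩
  have h1 : ‖quad x z‖ ≤ K * (1 + ‖z‖ ^ 2) := by
    have : ‖quad x z‖ ≤ |x.1 1 0| * ‖z‖ ^ 2 + 2 * |x.1 0 0| * ‖z‖ + |x.1 0 1| := by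
      refine (norm_sub_le _ _).trans ?_
      refine add_le_add ((norm_sub_le _ _).trans ?_) ?_
      · simp
      · simp
    have h2 : 2 * ‖z‖ ≤ 1 + ‖z‖ ^ 2 := by nlinarith [sq_nonneg (1 - ‖z‖)]
    have e0 := abs_nonneg (x.1 0 0)
    have e1 := abs_nonneg (x.1 1 0)
    have e2 := abs_nonneg (x.1 0 1)
    have e3 := mul_le_mul_of_nonneg_left h2 e0
    have e4 := mul_nonneg e2 (sq_nonneg ‖z‖)
    have e5 := mul_nonneg e0 (sq_nonneg ‖z‖)
    nlinarith [sq_nonneg ‖z‖]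
  rw [height_eq_norm, gauge, mul_div_assoc', ← mul_pow]
  rcases eq_or_ne z.im 0 with h | h
  · simp [h]
  have : ‖quad x z‖ ^ 2 ≤ (K * (1 + ‖z‖ ^ 2)) ^ 2 := by gcongr
  gcongr
  nlinarith [sq_nonneg z.im]

/-- The determinant of the matrix of inner products. -/
def gramDet (x y : TraceZero ℝ) : ℝ := qnorm x * qnorm y - (pair x y / 2) ^ 2

-- Up to the factor `-4`, the Gram determinant is the resultant of the two quadratics. Since it is
-- nonzero they have no common zero on the projective line, infinity included, and Bézout identities
-- make this quantitative.
set_option maxHeartbeats 1000000 in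
lemma one_add_norm_sq_le (x y : TraceZero ℝ) (h : gramDet x y ≠ 0) :
    ∃ δ, 0 < δ ∧ ∀ z : ℂ, δ * (1 + ‖z‖ ^ 2) ≤ ‖quad x z‖ + ‖quad y z‖ := by
  set c₁ := x.1 1 0
  set d₁ := -2 * x.1 0 0
  set e₁ := -x.1 0 1
  set c₂ := y.1 1 0
  set d₂ := -2 * y.1 0 0
  set e₂ := -y.1 0 1
  set X := c₁ * e₂ - c₂ * e₁ with hX
  set Y := c₁ * d₂ - c₂ * d₁ with hY
  set Z := d₁ * e₂ - d₂ * e₁ with hZ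
  have hres : X ^ 2 - Y * Z = -4 * gramDet x y := by
    rw [gramDet, qnorm_eq, qnorm_eq, pair_eq]
    simp only [X, Y, Z, c₁, d₁, e₁, c₂, d₂, e₂]
    ring
  have hr : 0 < |X ^ 2 - Y * Z| := by
    rw [hres]; exact abs_pos.2 (mul_ne_zero (by norm_num) h)
  set K := (|X| + |Y| + |Z| + 1) * (|c₁| + |c₂| + |d₁| + |d₂| + |e₁| + |e₂| + 1) with hK
  have hK0 : 0 < K := by positivity
  refine ⟨|X ^ 2 - Y * Z| / (16 * K), by positivity, fun z => ?_⟩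
  set p := quad x z with hp
  set q := quad y z with hq
  have hp' : p = c₁ * z ^ 2 + d₁ * z + e₁ := by
    simp only [hp, quad, c₁, d₁, e₁]; push_cast; ring
  have hq' : q = c₂ * z ^ 2 + d₂ * z + e₂ := by
    simp only [hq, quad, c₂, d₂, e₂]; push_cast; ring
  -- Bézout: the resultant times `1` and, in `i2`, times `z³` lie in the span of `p` and `q` with
  -- coefficients linear in `z`. The first controls bounded `z`, the second large `z`.
  have i1 : ((X ^ 2 - Y * Z : ℝ) : ℂ) = (X - Y * z) * (c₁ * q - c₂ * p)
      - Y * (d₁ * q - d₂ * p) := by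
    rw [hp', hq', hX, hY, hZ]; push_cast; ring
  have i2 : ((X ^ 2 - Y * Z : ℝ) : ℂ) * z ^ 3 = (Z - X * z) * (e₁ * q - e₂ * p)
      + Z * z * (d₁ * q - d₂ * p) := by
    rw [hp', hq', hX, hY, hZ]; push_cast; ring
  have key : ∀ a b c d : ℝ, |a| ≤ |X| + |Y| + |Z| + 1 → |b| ≤ |X| + |Y| + |Z| + 1 →
      |c| ≤ |c₁| + |c₂| + |d₁| + |d₂| + |e₁| + |e₂| + 1 →
      |d| ≤ |c₁| + |c₂| + |d₁| + |d₂| + |e₁| + |e₂| + 1 →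
      ‖((a : ℂ) - b * z) * (c * q - d * p)‖ ≤ K * ((1 + ‖z‖) * (‖p‖ + ‖q‖)) := by
    intro a b c d ha hb hc hd
    rw [norm_mul]
    have h1 : ‖(a : ℂ) - b * z‖ ≤ (|X| + |Y| + |Z| + 1) * (1 + ‖z‖) := by
      refine (norm_sub_le _ _).trans ?_
      rw [norm_mul, Complex.norm_real, Complex.norm_real, Real.norm_eq_abs, Real.norm_eq_abs]
      nlinarith [mul_le_mul_of_nonneg_right hb (norm_nonneg z)]
    have h2 : ‖(c : ℂ) * q - d * p‖ ≤
        (|c₁| + |c₂| + |d₁| + |d₂| + |e₁| + |e₂| + 1) * (‖p‖ + ‖q‖) := by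
      refine (norm_sub_le _ _).trans ?_
      rw [norm_mul, norm_mul, Complex.norm_real, Complex.norm_real, Real.norm_eq_abs,
        Real.norm_eq_abs]
      nlinarith [mul_le_mul_of_nonneg_right hc (norm_nonneg q),
        mul_le_mul_of_nonneg_right hd (norm_nonneg p)]
    calc _ ≤ ((|X| + |Y| + |Z| + 1) * (1 + ‖z‖)) *
          ((|c₁| + |c₂| + |d₁| + |d₂| + |e₁| + |e₂| + 1) * (‖p‖ + ‖q‖)) := by gcongr
      _ = _ := by rw [hK]; ring
  have aX := abs_nonneg X
  have aY := abs_nonneg Y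
  have aZ := abs_nonneg Z
  have bc1 := abs_nonneg c₁
  have bc2 := abs_nonneg c₂
  have bd1 := abs_nonneg d₁
  have bd2 := abs_nonneg d₂
  have be1 := abs_nonneg e₁
  have be2 := abs_nonneg e₂
  have j1 : |X ^ 2 - Y * Z| ≤ 2 * (K * ((1 + ‖z‖) * (‖p‖ + ‖q‖))) := by
    rw [← Real.norm_eq_abs, ← Complex.norm_real, i1]
    refine (norm_sub_le _ _).trans ?_
    have := key X Y c₁ c₂ (by linarith) (by linarith) (by linarith) (by linarith)
    have h2 := key Y 0 d₁ d₂ (by linarith) (by rw [abs_zero]; linarith) (by linarith)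
      (by linarith)
    rw [Complex.ofReal_zero, zero_mul, sub_zero] at h2
    linarith
  have j2 : |X ^ 2 - Y * Z| * ‖z‖ ^ 3 ≤ 2 * (K * ((1 + ‖z‖) * (‖p‖ + ‖q‖))) := by
    rw [← Real.norm_eq_abs, ← Complex.norm_real, ← norm_pow, ← norm_mul, i2]
    refine (norm_add_le _ _).trans ?_
    have := key Z X e₁ e₂ (by linarith) (by linarith) (by linarith) (by linarith)
    have h2 := key 0 (-Z) d₁ d₂ (by rw [abs_zero]; linarith) (by rw [abs_neg]; linarith)
      (by linarith) (by linarith)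
    rw [Complex.ofReal_zero, zero_sub, Complex.ofReal_neg, neg_mul (Z : ℂ), neg_neg] at h2
    linarith
  have hz := norm_nonneg z
  have j3 : (1 + ‖z‖) * (1 + ‖z‖ ^ 2) ≤ 4 * (1 + ‖z‖ ^ 3) := by
    have h1 : 0 ≤ (1 + ‖z‖) * (2 * (1 - ‖z‖) ^ 2 + ‖z‖ ^ 2 + 1) := by positivity
    linear_combination h1
  rw [div_mul_eq_mul_div, div_le_iff₀ (by positivity)]
  refine le_of_mul_le_mul_left (a := 1 + ‖z‖) ?_ (by positivity)
  calc (1 + ‖z‖) * (|X ^ 2 - Y * Z| * (1 + ‖z‖ ^ 2))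
      = |X ^ 2 - Y * Z| * ((1 + ‖z‖) * (1 + ‖z‖ ^ 2)) := by ring
    _ ≤ |X ^ 2 - Y * Z| * (4 * (1 + ‖z‖ ^ 3)) := by gcongr
    _ ≤ _ := by linear_combination 4 * j1 + 4 * j2

/-- The only place where nondegeneracy of the pair enters the decay estimates. On the real axis both
sides vanish by the convention for division by zero. -/
lemma gauge_le_height_add (x y : TraceZero ℝ) (h : gramDet x y ≠ 0) :
    ∃ σ, 0 < σ ∧ ∀ z : ℂ, σ * gauge z ≤ height x z + height y z := by
  obtain ⟨δ, hδ, hb⟩ := one_add_norm_sq_le x y h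
  -- `8 = 4 · 2`: the `4` is in the denominator of the height, the `2` comes from `(a + b)² ≤ 2(a² +
  -- b²)`.
  refine ⟨δ ^ 2 / 8, by positivity, fun z => ?_⟩
  rcases eq_or_ne z.im 0 with h | h
  · simp [height_eq_norm, gauge, h]
  rw [height_eq_norm, height_eq_norm, gauge, ← add_div, mul_div_assoc',
    div_le_div_iff₀ (by positivity) (by positivity)]
  have h1 : (δ * (1 + ‖z‖ ^ 2)) ^ 2 ≤ (‖quad x z‖ + ‖quad y z‖) ^ 2 := by
    gcongr
    exact hb z
  have h2 : (‖quad x z‖ + ‖quad y z‖) ^ 2 ≤ 2 * (‖quad x z‖ ^ 2 + ‖quad y z‖ ^ 2) := by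
    nlinarith [sq_nonneg (‖quad x z‖ - ‖quad y z‖)]
  have h3 : 0 < z.im ^ 2 := by positivity
  nlinarith

lemma pow_mul_exp_neg_le (n : ℕ) {κ : ℝ} (hκ : 0 < κ) :
    ∃ C, 0 < C ∧ ∀ r : ℝ, 0 ≤ r → r ^ n * Real.exp (-(κ * r)) ≤ C := by
  refine ⟨n.factorial / κ ^ n, by positivity, fun r hr => ?_⟩
  have h := Real.pow_div_factorial_le_exp (κ * r) (by positivity) n
  rw [Real.exp_neg, ← div_eq_mul_inv, div_le_div_iff₀ (Real.exp_pos _) (by positivity)]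
  rw [div_le_iff₀ (by positivity), mul_pow] at h
  linarith

/-- Powers of the gauge are absorbed by the exponential. -/
lemma gauge_pow_mul_exp_le (n : ℕ) {κ : ℝ} (hκ : 0 < κ) :
    ∃ C, 0 < C ∧ ∀ z : ℂ, z.im ≠ 0 →
      gauge z ^ n * Real.exp (-(κ * gauge z)) ≤ C * Real.exp (-(κ / 2) * ‖z‖ ^ 2) := by
  obtain ⟨C, hC, hb⟩ := pow_mul_exp_neg_le n (half_pos hκ)
  refine ⟨C, hC, fun z hz => ?_⟩
  have h4 := four_le_gauge hz
  have h := hb (gauge z) (by linarith)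
  -- Half of the exponent absorbs the power of the gauge; the other half becomes a Gaussian in `z`,
  -- because the gauge dominates `‖z‖ ^ 2`.
  have e : Real.exp (-(κ * gauge z)) =
      Real.exp (-(κ / 2 * gauge z)) * Real.exp (-(κ / 2) * gauge z) := by
    rw [← Real.exp_add]; ring_nf
  rw [e, ← mul_assoc]
  gcongr ?_ * Real.exp ?_
  have := norm_sq_le_gauge hz
  nlinarith

lemma integrable_exp_neg_norm_sq {κ : ℝ} (hκ : 0 < κ) :
    Integrable (fun z : ℂ => Real.exp (-κ * ‖z‖ ^ 2)) := by
  have h := (GaussianFourier.integrable_cexp_neg_mul_sq_norm_add (V := ℂ) (b := (κ : ℂ))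
    (by simpa using hκ) 0 0).norm
  refine h.congr (Eventually.of_forall fun z => ?_)
  simp only [zero_mul, add_zero, Complex.norm_exp]
  congr 1
  rw [← Complex.ofReal_pow, ← Complex.ofReal_neg, ← Complex.ofReal_mul, Complex.ofReal_re]

/-! ### The exponential integral and its truncation. -/

/-- The truncated exponential integral `∫₁ᵀ e^{-rs} s⁻¹ ds`. -/
def truncBeta (r T : ℝ) : ℝ := ∫ s in (1 : ℝ)..T, Real.exp (-r * s) * s⁻¹

lemma integrableOn_beta1 {r a : ℝ} (hr : 0 < r) (ha : 1 ≤ a) :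
    IntegrableOn (fun u => Real.exp (-r * u) * u⁻¹) (Set.Ioi a) := by
  have h := exp_neg_integrableOn_Ioi a hr
  refine Integrable.mono' h ?_ ?_
  · exact (by fun_prop : Measurable fun u : ℝ => Real.exp (-r * u) * u⁻¹).aestronglyMeasurable
  · filter_upwards [ae_restrict_mem measurableSet_Ioi] with u hu
    have hu1 : 1 < u := lt_of_le_of_lt ha hu
    rw [norm_mul, Real.norm_of_nonneg (Real.exp_pos _).le, Real.norm_of_nonneg (by positivity)]
    exact mul_le_of_le_one_right (Real.exp_pos _).le (inv_le_one_of_one_le₀ hu1.le)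

lemma beta1_nonneg (r : ℝ) : 0 ≤ beta1 r := by
  refine setIntegral_nonneg measurableSet_Ioi fun u hu => ?_
  have : 0 < u := lt_trans one_pos hu
  positivity

lemma beta1_le_exp_div {r : ℝ} (hr : 0 < r) : beta1 r ≤ Real.exp (-r) / r := by
  have h := integral_exp_mul_Ioi (neg_lt_zero.2 hr) 1
  have h2 : beta1 r ≤ ∫ u in Set.Ioi (1 : ℝ), Real.exp (-r * u) := by
    refine setIntegral_mono_on (integrableOn_beta1 hr le_rfl) (exp_neg_integrableOn_Ioi 1 hr)
      measurableSet_Ioi fun u hu => ?_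
    exact mul_le_of_le_one_right (Real.exp_pos _).le (inv_le_one_of_one_le₀ (le_of_lt hu))
  rw [h] at h2
  simpa using h2

/-- A single bound good at both ends: exponential decay at infinity, and at `0` the singularity `r ^
(-1/2)`. As `r` will be a height vanishing quadratically on the divisor, this is at worst a simple
pole there, hence integrable. -/
lemma beta1_le_exp_div_sqrt {r : ℝ} (hr : 0 < r) :
    beta1 r ≤ 4 * Real.exp (-(r / 2)) / Real.sqrt r := by
  have hi : IntegrableOn (fun u : ℝ => u ^ (-(3 / 2) : ℝ)) (Set.Ioi 1) :=
    integrableOn_Ioi_rpow_of_lt (by norm_num) one_pos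
  have h := integral_Ioi_rpow_of_lt (a := -(3 / 2)) (c := 1) (by norm_num) one_pos
  have key : beta1 r ≤ ∫ u in Set.Ioi (1 : ℝ),
      (2 * Real.exp (-(r / 2)) / Real.sqrt r) * u ^ (-(3 / 2) : ℝ) := by
    refine setIntegral_mono_on (integrableOn_beta1 hr le_rfl) (hi.const_mul _)
      measurableSet_Ioi fun u hu => ?_
    have hu1 : 1 < u := hu
    have hu0 : 0 < u := one_pos.trans hu1
    have e1 : Real.exp (-r * u) ≤ Real.exp (-(r / 2)) * Real.exp (-(r * u / 2)) := by
      rw [← Real.exp_add]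
      apply Real.exp_le_exp.2
      nlinarith
    have e2 : Real.exp (-(r * u / 2)) ≤ 2 / (Real.sqrt r * Real.sqrt u) := by
      rw [Real.exp_neg, ← Real.sqrt_mul hr.le, inv_eq_one_div,
        div_le_div_iff₀ (Real.exp_pos _) (Real.sqrt_pos.2 (by positivity)), one_mul]
      have h1 := Real.add_one_le_exp (r * u / 2)
      have h2 := Real.sq_sqrt (show 0 ≤ r * u by positivity)
      nlinarith [sq_nonneg (Real.sqrt (r * u) - 1)]
    have e3 : u ^ (-(3 / 2) : ℝ) = (Real.sqrt u)⁻¹ * u⁻¹ := by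
      rw [Real.sqrt_eq_rpow, ← Real.rpow_neg hu0.le, ← Real.rpow_neg_one u,
        ← Real.rpow_add hu0]
      norm_num
    rw [e3]
    calc Real.exp (-r * u) * u⁻¹
        ≤ (Real.exp (-(r / 2)) * (2 / (Real.sqrt r * Real.sqrt u))) * u⁻¹ := by
          gcongr
          exact e1.trans (by gcongr)
      _ = _ := by field_simp
  rw [integral_const_mul, h] at key
  refine key.trans (le_of_eq ?_)
  norm_num
  ring

/-- The measure `du/u` is invariant under scaling. Hence truncation at `T` removes exactly `beta1 (r
* T)`, and `beta1` is an integral of `e^{-u}/u` from `r`, which gives its derivative. -/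
lemma integral_Ioi_exp_eq_beta1 {T : ℝ} (r : ℝ) (hT : 0 < T) :
    ∫ u in Set.Ioi T, Real.exp (-r * u) * u⁻¹ = beta1 (r * T) := by
  have h := integral_comp_mul_left_Ioi (fun u => Real.exp (-r * u) * u⁻¹) 1 hT
  rw [mul_one, smul_eq_mul] at h
  rw [beta1]
  have h2 : ∫ u in Set.Ioi (1 : ℝ), Real.exp (-r * (T * u)) * (T * u)⁻¹
      = T⁻¹ * ∫ u in Set.Ioi (1 : ℝ), Real.exp (-(r * T) * u) * u⁻¹ := by
    rw [← integral_const_mul]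
    congr 1
    ext u
    rw [mul_inv]
    ring_nf
  rw [h2] at h
  exact (mul_left_cancel₀ (inv_ne_zero hT.ne') h).symm

lemma truncBeta_eq {r T : ℝ} (hr : 0 < r) (hT : 1 ≤ T) :
    truncBeta r T = beta1 r - beta1 (r * T) := by
  rw [← integral_Ioi_exp_eq_beta1 r (one_pos.trans_le hT), truncBeta, beta1,
    intervalIntegral.integral_Ioi_sub_Ioi (integrableOn_beta1 hr le_rfl) hT]

lemma truncBeta_nonneg {T : ℝ} (r : ℝ) (hT : 1 ≤ T) : 0 ≤ truncBeta r T := by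
  refine intervalIntegral.integral_nonneg hT fun u hu => ?_
  have : 0 < u := one_pos.trans_le hu.1
  positivity

lemma truncBeta_le_beta1 {r T : ℝ} (hr : 0 < r) (hT : 1 ≤ T) : truncBeta r T ≤ beta1 r := by
  rw [truncBeta_eq hr hT]
  linarith [beta1_nonneg (r * T)]

lemma continuousOn_exp_mul_inv (r a b : ℝ) (ha : 1 ≤ a) (hb : 1 ≤ b) :
    ContinuousOn (fun s : ℝ => Real.exp (-r * s) * s⁻¹) (Set.uIcc a b) := by
  refine ContinuousOn.mul (by fun_prop) (continuousOn_id.inv₀ fun s hs => ?_)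
  have : min a b ≤ s := hs.1
  have : 1 ≤ min a b := le_min ha hb
  simp only [id]
  linarith

lemma truncBeta_le {r T : ℝ} (hr : 0 ≤ r) (hT : 1 ≤ T) : truncBeta r T ≤ Real.exp (-r) * T := by
  have h : truncBeta r T ≤ ∫ _ in (1 : ℝ)..T, Real.exp (-r) := by
    refine intervalIntegral.integral_mono_on hT
      (continuousOn_exp_mul_inv r 1 T le_rfl hT).intervalIntegrable (by simp) fun u hu => ?_
    have hu0 : 0 < u := one_pos.trans_le hu.1
    calc _ ≤ Real.exp (-r * u) * 1 := by
          gcongr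
          exact inv_le_one_of_one_le₀ hu.1
      _ ≤ _ := by
          rw [mul_one]
          apply Real.exp_le_exp.2
          nlinarith [hu.1]
  rw [intervalIntegral.integral_const, smul_eq_mul] at h
  nlinarith [Real.exp_pos (-r)]

lemma hasDerivAt_beta1 {r : ℝ} (hr : 0 < r) : HasDerivAt beta1 (-(Real.exp (-r) * r⁻¹)) r := by
  have hc : ContinuousAt (fun s : ℝ => Real.exp (-1 * s) * s⁻¹) r :=
    ContinuousAt.mul (by fun_prop) (continuousAt_inv₀ hr.ne')
  have hii : ∀ t, 0 < t → IntegrableOn (fun u : ℝ => Real.exp (-1 * u) * u⁻¹) (Set.Ioi t) := by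
    intro t ht
    have h := integrableOn_beta1 one_pos (le_max_right t 1)
    rcases le_total t 1 with h1 | h1
    · rw [max_eq_right h1] at h
      rw [← Set.Ioc_union_Ioi_eq_Ioi h1]
      refine IntegrableOn.union ?_ h
      have : ContinuousOn (fun u : ℝ => Real.exp (-1 * u) * u⁻¹) (Set.Icc t 1) := by
        refine ContinuousOn.mul (by fun_prop) (continuousOn_id.inv₀ fun s hs => ?_)
        exact (ht.trans_le hs.1).ne'
      exact (this.integrableOn_Icc).mono_set Set.Ioc_subset_Icc_self
    · rwa [max_eq_left h1] at h
  have hF : HasDerivAt (fun t => ∫ u in r..t, Real.exp (-1 * u) * u⁻¹)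
      (Real.exp (-1 * r) * r⁻¹) r :=
    intervalIntegral.integral_hasDerivAt_right (by simp)
      (by
        refine ⟨Set.univ, univ_mem, ?_⟩
        exact (by fun_prop : Measurable fun u : ℝ => Real.exp (-1 * u) * u⁻¹).aestronglyMeasurable)
      hc
  have hG := hF.const_sub (beta1 r)
  rw [neg_one_mul] at hG
  refine hG.congr_of_eventuallyEq ?_
  filter_upwards [Ioi_mem_nhds hr] with t ht
  have e1 := integral_Ioi_exp_eq_beta1 1 hr
  have e2 := integral_Ioi_exp_eq_beta1 1 (show 0 < t from ht)
  rw [one_mul] at e1 e2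
  rw [← e1, ← e2, eq_sub_iff_add_eq, add_comm]
  exact intervalIntegral.integral_interval_add_Ioi (hii r hr) (hii t ht)

lemma measurable_beta1 : Measurable beta1 := by
  have : StronglyMeasurable fun r : ℝ => ∫ u, Real.exp (-r * u) * u⁻¹
      ∂(volume.restrict (Set.Ioi (1 : ℝ))) :=
    StronglyMeasurable.integral_prod_right'
      (f := fun p : ℝ × ℝ => Real.exp (-p.1 * p.2) * p.2⁻¹)
      (by fun_prop : Measurable fun p : ℝ × ℝ => Real.exp (-p.1 * p.2) * p.2⁻¹).stronglyMeasurable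
  exact this.measurable

lemma tendsto_beta1_atTop : Tendsto beta1 atTop (𝓝 0) := by
  refine tendsto_of_tendsto_of_tendsto_of_le_of_le' tendsto_const_nhds
    (Real.tendsto_exp_neg_atTop_nhds_zero) (Eventually.of_forall beta1_nonneg) ?_
  filter_upwards [eventually_ge_atTop 1] with r hr
  refine (beta1_le_exp_div (by linarith)).trans ?_
  exact div_le_self (Real.exp_pos _).le hr

lemma tendsto_truncBeta {ι : Type*} {l : Filter ι} {r T : ι → ℝ} {r₀ : ℝ} (hr₀ : 0 < r₀)
    (hr : Tendsto r l (𝓝 r₀)) (hT : Tendsto T l atTop) :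
    Tendsto (fun i => truncBeta (r i) (T i)) l (𝓝 (beta1 r₀)) := by
  have h1 : Tendsto (fun i => beta1 (r i) - beta1 (r i * T i)) l (𝓝 (beta1 r₀ - 0)) :=
    ((hasDerivAt_beta1 hr₀).continuousAt.tendsto.comp hr).sub
      (tendsto_beta1_atTop.comp (hr.pos_mul_atTop hr₀ hT))
  rw [sub_zero] at h1
  refine h1.congr' ?_
  filter_upwards [hr.eventually (lt_mem_nhds hr₀), hT.eventually_ge_atTop 1] with i hi hTi
  exact (truncBeta_eq hi hTi).symm

/-! ### Differential calculus of `lin`, and the density of `ω`. -/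

/-- The inner product of `x` with the positive line attached to `z`. -/
def lin (x : TraceZero ℝ) (z : ℂ) : ℝ :=
  (x.1 1 0 * (z.re ^ 2 + z.im ^ 2) - 2 * x.1 0 0 * z.re - x.1 0 1) / (2 * z.im)

/-- The derivative of `lin` in the real direction. -/
def linRe (x : TraceZero ℝ) (z : ℂ) : ℝ := (x.1 1 0 * z.re - x.1 0 0) / z.im

/-- The derivative of `lin` in the imaginary direction. -/
def linIm (x : TraceZero ℝ) (z : ℂ) : ℝ := x.1 1 0 - lin x z / z.im

lemma height_eq_lin (x : TraceZero ℝ) {z : ℂ} (hz : z.im ≠ 0) :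
    height x z = lin x z ^ 2 - qnorm x := by
  rw [eq_sub_iff_add_eq, height_add_qnorm x hz, lin]

/-- The squared hyperbolic gradient of `lin x` is the height. With the eigenfunction equation `y² Δ
lin = 2 lin`, this makes the Laplacian of any function of `lin x` explicit. -/
lemma lin_grad_sq (x : TraceZero ℝ) {z : ℂ} (hz : z.im ≠ 0) :
    z.im ^ 2 * (linRe x z ^ 2 + linIm x z ^ 2) = lin x z ^ 2 - qnorm x := by
  rw [qnorm_eq, linRe, linIm, lin]
  field_simp
  ring

lemma hasFDerivAt_re (z : ℂ) : HasFDerivAt (fun w : ℂ => w.re) Complex.reCLM z :=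
  Complex.reCLM.hasFDerivAt

lemma hasFDerivAt_im (z : ℂ) : HasFDerivAt (fun w : ℂ => w.im) Complex.imCLM z :=
  Complex.imCLM.hasFDerivAt

lemma hasFDerivAt_inv_im {z : ℂ} (hz : z.im ≠ 0) :
    HasFDerivAt (fun w : ℂ => w.im⁻¹) ((-(z.im ^ 2)⁻¹) • Complex.imCLM) z :=
  (hasDerivAt_inv hz).comp_hasFDerivAt z (hasFDerivAt_im z)

lemma hasFDerivAt_lin (x : TraceZero ℝ) {z : ℂ} (hz : z.im ≠ 0) :
    HasFDerivAt (lin x) (linRe x z • Complex.reCLM + linIm x z • Complex.imCLM) z := by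
  have h1 := (((((hasFDerivAt_re z).pow 2).add ((hasFDerivAt_im z).pow 2)).const_mul
    (x.1 1 0)).sub ((hasFDerivAt_re z).const_mul (2 * x.1 0 0))).sub_const (x.1 0 1)
  have h2 := (h1.mul (hasFDerivAt_inv_im hz)).const_mul (1 / 2)
  refine (h2.congr_fderiv ?_).congr_of_eventuallyEq (Eventually.of_forall fun w => ?_)
  · ext w
    simp [linRe, linIm, lin]
    field_simp
    ring
  · simp only [lin]
    rw [div_eq_mul_inv, mul_inv]
    simp
    ring

lemma hasFDerivAt_linRe (x : TraceZero ℝ) {z : ℂ} (hz : z.im ≠ 0) :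
    HasFDerivAt (linRe x)
      ((x.1 1 0 / z.im) • Complex.reCLM + (-linRe x z / z.im) • Complex.imCLM) z := by
  have h2 := (((hasFDerivAt_re z).const_mul (x.1 1 0)).sub_const (x.1 0 0)).mul
    (hasFDerivAt_inv_im hz)
  refine (h2.congr_fderiv ?_).congr_of_eventuallyEq (Eventually.of_forall fun w => ?_)
  · ext w
    simp [linRe]
    field_simp
    ring
  · simp only [linRe]
    rw [div_eq_mul_inv]
    rfl

lemma hasFDerivAt_linIm (x : TraceZero ℝ) {z : ℂ} (hz : z.im ≠ 0) :
    HasFDerivAt (linIm x)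
      ((-linRe x z / z.im) • Complex.reCLM +
        (2 * lin x z / z.im ^ 2 - x.1 1 0 / z.im) • Complex.imCLM) z := by
  have h2 := ((hasFDerivAt_lin x hz).mul (hasFDerivAt_inv_im hz)).const_sub (x.1 1 0)
  refine (h2.congr_fderiv ?_).congr_of_eventuallyEq (Eventually.of_forall fun w => ?_)
  · ext w
    simp [linIm]
    field_simp
    ring
  · simp only [linIm]
    rw [div_eq_mul_inv]
    rfl

lemma eventually_im_ne_zero {z : ℂ} (hz : z.im ≠ 0) : ∀ᶠ w in 𝓝 z, w.im ≠ 0 :=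
  Complex.continuous_im.continuousAt.eventually_ne hz

open InnerProductSpace Laplacian in
lemma laplacian_eq_of_hasFDerivAt {f A B : ℂ → ℝ} {A' B' : ℂ →L[ℝ] ℝ} {z : ℂ}
    (hf : ∀ᶠ w in 𝓝 z, HasFDerivAt f (A w • Complex.reCLM + B w • Complex.imCLM) w)
    (hA : HasFDerivAt A A' z) (hB : HasFDerivAt B B' z) :
    (Δ f) z = A' 1 + B' Complex.I := by
  have h1 : fderiv ℝ f =ᶠ[𝓝 z] fun w => A w • Complex.reCLM + B w • Complex.imCLM := by
    filter_upwards [hf] with w hw using hw.fderiv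
  have h2 := (hA.smul_const Complex.reCLM).add (hB.smul_const Complex.imCLM)
  have h3 : fderiv ℝ (fderiv ℝ f) z = _ := (h2.congr_of_eventuallyEq h1).fderiv
  rw [laplacian_eq_iteratedFDeriv_complexPlane]
  simp only [iteratedFDeriv_two_apply, h3]
  simp

open InnerProductSpace Laplacian in
/-- The hyperbolic Laplacian of a function of `lin x`. -/
lemma laplacian_comp_lin (x : TraceZero ℝ) {F F' : ℝ → ℝ} {F'' : ℝ} {z : ℂ} (hz : z.im ≠ 0)
    (hF : ∀ᶠ s in 𝓝 (lin x z), HasDerivAt F (F' s) s) (hF' : HasDerivAt F' F'' (lin x z)) :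
    (Δ (fun w => F (lin x w))) z =
      (F'' * (lin x z ^ 2 - qnorm x) + 2 * lin x z * F' (lin x z)) / z.im ^ 2 := by
  have hl := hasFDerivAt_lin x hz
  have hF'l := hF'.comp_hasFDerivAt z hl
  rw [laplacian_eq_of_hasFDerivAt (A := fun w => F' (lin x w) * linRe x w)
    (B := fun w => F' (lin x w) * linIm x w) ?_ (hF'l.mul (hasFDerivAt_linRe x hz))
    (hF'l.mul (hasFDerivAt_linIm x hz))]
  · rw [← lin_grad_sq x hz]
    simp
    field_simp
    ring
  · filter_upwards [hl.continuousAt.eventually hF, eventually_im_ne_zero hz] with w hw hwz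
    refine (hw.comp_hasFDerivAt w (hasFDerivAt_lin x hwz)).congr_fderiv ?_
    ext v
    simp
    ring

/-- The Gaussian `e^{-2πtR(x,z)}`. -/
def gauss (x : TraceZero ℝ) (t : ℝ) (z : ℂ) : ℝ := Real.exp (-(2 * Real.pi * height x z) * t)

/-- The density of the form `ω(√t x)` with respect to Lebesgue measure. -/
def omega (x : TraceZero ℝ) (t : ℝ) (z : ℂ) : ℝ :=
  gauss x t z * (2 * t * (height x z + qnorm x) - (2 * Real.pi)⁻¹) / z.im ^ 2

lemma xi_point (x : TraceZero ℝ) (z : ℂ) : xi x (point z) = beta1 (2 * Real.pi * height x z) := rfl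

/-- Near `z`, `ξ(x)` is a function of `lin x` alone, so `laplacian_comp_lin` applies. The powers of
`1/R` in the second derivative cancel, so the resulting formula stays regular on the divisor. -/
lemma ddc_xi (x : TraceZero ℝ) {z : ℂ} (hz : z.im ≠ 0) (h : 0 < height x z) :
    ddc (xi x) z = omega x 1 z := by
  have hpi := Real.pi_pos
  have hE : (fun w : ℂ => xi x (point w)) =ᶠ[𝓝 z]
      fun w => (fun s => beta1 (2 * Real.pi * (s ^ 2 - qnorm x))) (lin x w) := by
    filter_upwards [eventually_im_ne_zero hz] with w hw
    rw [xi_point, height_eq_lin x hw]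
  have hR : height x z = lin x z ^ 2 - qnorm x := height_eq_lin x hz
  rw [ddc, (InnerProductSpace.laplacian_congr_nhds hE).self_of_nhds,
    laplacian_comp_lin x hz (F := fun s => beta1 (2 * Real.pi * (s ^ 2 - qnorm x)))
      (F' := fun s => -(Real.exp (-(2 * Real.pi * (s ^ 2 - qnorm x))) *
      (s ^ 2 - qnorm x)⁻¹ * (2 * s)))
      (F'' := Real.exp (-(2 * Real.pi * height x z)) * (-2 / height x z +
        8 * Real.pi * lin x z ^ 2 / height x z + 4 * lin x z ^ 2 / height x z ^ 2))]
  · rw [omega, gauss, ← hR, show lin x z ^ 2 = height x z + qnorm x by linarith, mul_one]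
    field_simp
    rw [show lin x z ^ 2 = height x z + qnorm x by linarith]
    ring
  · have hc : ContinuousAt (fun s : ℝ => s ^ 2 - qnorm x) (lin x z) := by fun_prop
    filter_upwards [hc.eventually (lt_mem_nhds (show 0 < lin x z ^ 2 - qnorm x by rwa [← hR]))]
      with s hs
    have h1 : HasDerivAt (fun s : ℝ => 2 * Real.pi * (s ^ 2 - qnorm x))
        (2 * Real.pi * (2 * s)) s := by
      simpa using ((hasDerivAt_pow 2 s).sub_const (qnorm x)).const_mul (2 * Real.pi)
    refine ((hasDerivAt_beta1 (by positivity)).comp s h1).congr_deriv ?_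
    field_simp
  · have h1 : HasDerivAt (fun s : ℝ => s ^ 2 - qnorm x) (2 * lin x z) (lin x z) := by
      simpa using (hasDerivAt_pow 2 (lin x z)).sub_const (qnorm x)
    have h2 := ((((h1.const_mul (2 * Real.pi)).neg.exp).mul
      (h1.inv (by rw [← hR]; exact h.ne'))).mul ((hasDerivAt_id (lin x z)).const_mul 2)).neg
    refine h2.congr_deriv ?_
    simp only [Pi.inv_apply, Pi.mul_apply, Pi.neg_apply, id, ← hR]
    field_simp
    ring

/-! ### Integrability and integration by parts on the plane. -/

lemma abs_inv_le_gauge {z : ℂ} (hz : z.im ≠ 0) : |z.im|⁻¹ ≤ gauge z := by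
  have h1 := inv_sq_le_gauge hz
  have h2 := four_le_gauge hz
  have h3 : 0 ≤ |z.im|⁻¹ := by positivity
  rw [← sq_abs, ← inv_pow] at h1
  nlinarith [sq_nonneg (|z.im|⁻¹ - 1)]

lemma lin_bounds (x : TraceZero ℝ) : ∃ C, 0 < C ∧ ∀ z : ℂ, z.im ≠ 0 →
    |lin x z| ≤ C * gauge z ∧ |linRe x z| ≤ C * gauge z ∧ |linIm x z| ≤ C * gauge z ∧
      |x.1 1 0 / z.im| ≤ C * gauge z := by
  obtain ⟨C, hC, hb⟩ := height_le_gauge x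
  set K := C + |qnorm x| + |x.1 1 0| + 1 with hK
  refine ⟨K, by positivity, fun z hz => ?_⟩
  have h4 := four_le_gauge hz
  have hi := inv_sq_le_gauge hz
  have hR := hb z
  have hR' := height_eq_lin x hz
  have hv : 0 < z.im ^ 2 := by positivity
  have hg := lin_grad_sq x hz
  have a1 := abs_nonneg (qnorm x)
  have a2 := abs_nonneg (x.1 1 0)
  have a3 := le_abs_self (qnorm x)
  have hK1 : C + |qnorm x| ≤ K ^ 2 := by nlinarith
  have hsq : ∀ w : ℝ, w ^ 2 ≤ K ^ 2 * gauge z ^ 2 → |w| ≤ K * gauge z := by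
    intro w hw
    rw [← mul_pow] at hw
    exact abs_le_of_sq_le_sq hw (by positivity)
  have hgrad : linRe x z ^ 2 + linIm x z ^ 2 ≤ K ^ 2 * gauge z ^ 2 := by
    -- By `lin_grad_sq` both partial derivatives are controlled at once by the height.
    have e : linRe x z ^ 2 + linIm x z ^ 2 = (z.im ^ 2)⁻¹ * height x z := by
      rw [hR', ← hg]; field_simp
    rw [e]
    calc (z.im ^ 2)⁻¹ * height x z ≤ gauge z * (C * gauge z) := by
          have := height_nonneg x z
          gcongr
      _ = C * gauge z ^ 2 := by ring
      _ ≤ _ := by gcongr; linarith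
  refine ⟨hsq _ ?_, hsq _ ?_, hsq _ ?_, ?_⟩
  · calc lin x z ^ 2 = height x z + qnorm x := by linarith
      _ ≤ C * gauge z + |qnorm x| := by linarith
      _ ≤ (C + |qnorm x|) * gauge z ^ 2 := by
        nlinarith [mul_nonneg hC.le (by nlinarith : 0 ≤ gauge z ^ 2 - gauge z),
          mul_nonneg a1 (by nlinarith : 0 ≤ gauge z ^ 2 - 1)]
      _ ≤ _ := by gcongr
  · nlinarith [sq_nonneg (linIm x z)]
  · nlinarith [sq_nonneg (linRe x z)]
  · rw [abs_div, div_eq_mul_inv]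
    have := abs_inv_le_gauge hz
    gcongr
    linarith

lemma ae_im_ne_zero : ∀ᵐ z : ℂ, z.im ≠ 0 := by
  rw [← Complex.volume_preserving_equiv_real_prod.symm.map_eq,
    (Complex.measurableEquivRealProd.symm.measurableEmbedding).ae_map_iff]
  have h : ∀ᵐ y : ℝ, y ≠ 0 := by simp [ae_iff]
  exact (Measure.quasiMeasurePreserving_snd (μ := (volume : Measure ℝ))
    (ν := (volume : Measure ℝ))).ae h

lemma restrict_nonreal : (volume : Measure ℂ).restrict nonreal = volume :=
  Measure.restrict_eq_self_of_ae_mem ae_im_ne_zero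

lemma integrable_of_le_gauge {h : ℂ → ℝ} (hm : AEStronglyMeasurable h volume) {C κ : ℝ} (n : ℕ)
    (hκ : 0 < κ)
    (hb : ∀ z : ℂ, z.im ≠ 0 → |h z| ≤ C * (gauge z ^ n * Real.exp (-(κ * gauge z)))) :
    Integrable h := by
  obtain ⟨C', hC', hb'⟩ := gauge_pow_mul_exp_le n hκ
  refine Integrable.mono' ((integrable_exp_neg_norm_sq (half_pos hκ)).const_mul (|C| * C')) hm ?_
  filter_upwards [ae_im_ne_zero] with z hz
  have h4 := four_le_gauge hz
  calc ‖h z‖ ≤ C * (gauge z ^ n * Real.exp (-(κ * gauge z))) := hb z hz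
    _ ≤ |C| * (gauge z ^ n * Real.exp (-(κ * gauge z))) := by
        gcongr
        exact le_abs_self C
    _ ≤ |C| * (C' * Real.exp (-(κ / 2) * ‖z‖ ^ 2)) := by
        exact mul_le_mul_of_nonneg_left (hb' z hz) (abs_nonneg C)
    _ = _ := by ring

/-- By Fubini this reduces to lines, where an integrable function with integrable derivative has
total variation integral zero. The derivative must exist everywhere, so the vertical analogue has to
cross the real axis. -/
lemma integral_deriv_re_eq_zero {U U' : ℂ → ℝ} (hU : Integrable U) (hU' : Integrable U')
    (h : ∀ z : ℂ, HasDerivAt (fun u : ℝ => U ⟨u, z.im⟩) (U' z) z.re) : ∫ z, U' z = 0 := by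
  have e := Complex.volume_preserving_equiv_real_prod.symm
  have em := Complex.measurableEquivRealProd.symm.measurableEmbedding
  rw [← e.integral_comp em]
  have i1 := (e.integrable_comp_emb em).2 hU
  have i2 := (e.integrable_comp_emb em).2 hU'
  rw [Measure.volume_eq_prod] at i1 i2 ⊢
  refine (integral_prod_symm _ i2).trans (integral_eq_zero_of_ae ?_)
  filter_upwards [i1.prod_left_ae, i2.prod_left_ae] with v h1 h2
  exact integral_eq_zero_of_hasDerivAt_of_integrable (fun u => h ⟨u, v⟩) h2 h1

lemma integral_deriv_im_eq_zero {U U' : ℂ → ℝ} (hU : Integrable U) (hU' : Integrable U')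
    (h : ∀ z : ℂ, HasDerivAt (fun v : ℝ => U ⟨z.re, v⟩) (U' z) z.im) : ∫ z, U' z = 0 := by
  have e := Complex.volume_preserving_equiv_real_prod.symm
  have em := Complex.measurableEquivRealProd.symm.measurableEmbedding
  rw [← e.integral_comp em]
  have i1 := (e.integrable_comp_emb em).2 hU
  have i2 := (e.integrable_comp_emb em).2 hU'
  rw [Measure.volume_eq_prod] at i1 i2 ⊢
  refine (integral_prod _ i2).trans (integral_eq_zero_of_ae ?_)
  filter_upwards [i1.prod_right_ae, i2.prod_right_ae] with u h1 h2
  exact integral_eq_zero_of_hasDerivAt_of_integrable (fun v => h ⟨u, v⟩) h2 h1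

lemma hasDerivAt_re_of_hasFDerivAt {f : ℂ → ℝ} {f' : ℂ →L[ℝ] ℝ} {z : ℂ} (h : HasFDerivAt f f' z) :
    HasDerivAt (fun u : ℝ => f ⟨u, z.im⟩) (f' 1) z.re := by
  have hc : HasDerivAt (fun u : ℝ => (u : ℂ) + (z.im : ℂ) * Complex.I) 1 z.re :=
    (Complex.ofRealCLM.hasDerivAt (x := z.re)).add_const _
  rw [← Complex.re_add_im z] at h
  have := HasFDerivAt.comp_hasDerivAt
    z.re (f := fun u : ℝ => (u : ℂ) + (z.im : ℂ) * Complex.I)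
    (by simpa using h) hc
  refine this.congr_of_eventuallyEq (Eventually.of_forall fun u => ?_)
  simp only [Function.comp, ← Complex.mk_eq_add_mul_I]

lemma hasDerivAt_im_of_hasFDerivAt {f : ℂ → ℝ} {f' : ℂ →L[ℝ] ℝ} {z : ℂ} (h : HasFDerivAt f f' z) :
    HasDerivAt (fun v : ℝ => f ⟨z.re, v⟩) (f' Complex.I) z.im := by
  have hc : HasDerivAt (fun v : ℝ => (z.re : ℂ) + (v : ℂ) * Complex.I) (1 * Complex.I) z.im :=
    ((Complex.ofRealCLM.hasDerivAt (x := z.im)).mul_const Complex.I).const_add _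
  rw [one_mul] at hc
  rw [← Complex.re_add_im z] at h
  have := HasFDerivAt.comp_hasDerivAt
    z.im (f := fun v : ℝ => (z.re : ℂ) + (v : ℂ) * Complex.I)
    (by simpa using h) hc
  refine this.congr_of_eventuallyEq (Eventually.of_forall fun u => ?_)
  simp only [Function.comp, ← Complex.mk_eq_add_mul_I]

lemma measurable_lin (x : TraceZero ℝ) : Measurable (lin x) := by
  unfold lin; fun_prop

lemma measurable_linRe (x : TraceZero ℝ) : Measurable (linRe x) := by
  unfold linRe; fun_prop

lemma measurable_linIm (x : TraceZero ℝ) : Measurable (linIm x) := by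
  have := measurable_lin x
  unfold linIm; fun_prop

lemma measurable_gauss (x : TraceZero ℝ) (t : ℝ) : Measurable (gauss x t) := by
  have := measurable_height x
  unfold gauss; fun_prop

lemma gauss_pos (x : TraceZero ℝ) (t : ℝ) (z : ℂ) : 0 < gauss x t z := Real.exp_pos _

/-! ### Green's formula for two Gaussians. -/

/-- `(4π)⁻¹` times the Laplacian of `gauss x t`. -/
def ddcGauss (x : TraceZero ℝ) (t : ℝ) (z : ℂ) : ℝ :=
  gauss x t z * (-3 * t * height x z - 2 * t * qnorm x +
    4 * Real.pi * t ^ 2 * height x z * (height x z + qnorm x)) / z.im ^ 2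

/-- The second real derivative of `gauss x t`. -/
def gaussReRe (x : TraceZero ℝ) (t : ℝ) (z : ℂ) : ℝ :=
  gauss x t z * ((4 * Real.pi * t * lin x z * linRe x z) ^ 2 -
    4 * Real.pi * t * (linRe x z ^ 2 + lin x z * (x.1 1 0 / z.im)))

/-- The second imaginary derivative of `gauss x t`. -/
def gaussImIm (x : TraceZero ℝ) (t : ℝ) (z : ℂ) : ℝ :=
  gauss x t z * ((4 * Real.pi * t * lin x z * linIm x z) ^ 2 -
    4 * Real.pi * t * (linIm x z ^ 2 + lin x z * (2 * lin x z / z.im ^ 2 - x.1 1 0 / z.im)))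

lemma gaussReRe_add_gaussImIm (x : TraceZero ℝ) (t : ℝ) {z : ℂ} (hz : z.im ≠ 0) :
    gaussReRe x t z + gaussImIm x t z = 4 * Real.pi * ddcGauss x t z := by
  have h1 := lin_grad_sq x hz
  have h2 := height_eq_lin x hz
  have h3 : linRe x z ^ 2 = height x z / z.im ^ 2 - linIm x z ^ 2 := by
    rw [h2, ← h1]; field_simp; ring
  have h4 : qnorm x = lin x z ^ 2 - height x z := by linarith
  rw [gaussReRe, gaussImIm, ddcGauss, h4]
  have e : (4 * Real.pi * t * lin x z * linRe x z) ^ 2 =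
    (4 * Real.pi * t * lin x z) ^ 2 * linRe x z ^ 2 := by ring
  rw [e, h3]
  field_simp
  ring

lemma hasFDerivAt_gauss (x : TraceZero ℝ) (t : ℝ) {z : ℂ} (hz : z.im ≠ 0) :
    HasFDerivAt (gauss x t) ((-(4 * Real.pi * t) * lin x z * gauss x t z * linRe x z) •
      Complex.reCLM + (-(4 * Real.pi * t) * lin x z * gauss x t z * linIm x z) •
      Complex.imCLM) z := by
  have h := ((((((hasFDerivAt_lin x hz).pow 2).sub_const (qnorm x)).const_mul
    (2 * Real.pi)).neg).mul_const t).exp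
  have hE : gauss x t =ᶠ[𝓝 z]
      fun w => Real.exp (-(2 * Real.pi * (lin x w ^ 2 - qnorm x)) * t) := by
    filter_upwards [eventually_im_ne_zero hz] with w hw
    rw [gauss, height_eq_lin x hw]
  refine (h.congr_of_eventuallyEq hE).congr_fderiv ?_
  rw [hE.self_of_nhds]
  ext w
  simp
  ring

/-- The real component of `f ∇g - g ∇f` for two Gaussians. -/
def fluxRe (x y : TraceZero ℝ) (s t : ℝ) (z : ℂ) : ℝ :=
  gauss x s z * gauss y t z *
    (t * (lin y z * linRe y z) - s * (lin x z * linRe x z))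

/-- The imaginary component of `f ∇g - g ∇f` for two Gaussians. -/
def fluxIm (x y : TraceZero ℝ) (s t : ℝ) (z : ℂ) : ℝ :=
  gauss x s z * gauss y t z *
    (t * (lin y z * linIm y z) - s * (lin x z * linIm x z))

/-- The flux is `(4π)⁻¹ (g_y ∇g_x - g_x ∇g_y)`, normalised so that its divergence is the integrand
of Green's formula; the products of first derivatives cancel. -/
lemma hasDerivAt_fluxRe (x y : TraceZero ℝ) (s t : ℝ) (z : ℂ) :
    HasDerivAt (fun u : ℝ => fluxRe x y s t ⟨u, z.im⟩)
      ((4 * Real.pi)⁻¹ * (gauss y t z * gaussReRe x s z - gauss x s z * gaussReRe y t z))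
      z.re := by
  rcases eq_or_ne z.im 0 with hz | hz
  -- On the real axis division by zero makes `lin` and `linRe` vanish, so both the flux and its
  -- claimed derivative are zero.
  · have h0 : (fun u : ℝ => fluxRe x y s t ⟨u, z.im⟩) = fun _ => 0 := by
      ext u; simp [fluxRe, lin, hz]
    rw [h0]
    refine (hasDerivAt_const _ _).congr_deriv ?_
    simp [gaussReRe, lin, linRe, hz]
  · have h := ((hasFDerivAt_gauss x s hz).mul (hasFDerivAt_gauss y t hz)).mul
      ((((hasFDerivAt_lin y hz).mul (hasFDerivAt_linRe y hz)).const_mul t).sub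
        (((hasFDerivAt_lin x hz).mul (hasFDerivAt_linRe x hz)).const_mul s))
    refine (hasDerivAt_re_of_hasFDerivAt h).congr_deriv ?_
    have := Real.pi_pos
    simp [gaussReRe]
    field_simp
    ring

lemma hasDerivAt_fluxIm (x y : TraceZero ℝ) (s t : ℝ) {z : ℂ} (hz : z.im ≠ 0) :
    HasDerivAt (fun v : ℝ => fluxIm x y s t ⟨z.re, v⟩)
      ((4 * Real.pi)⁻¹ * (gauss y t z * gaussImIm x s z - gauss x s z * gaussImIm y t z))
      z.im := by
  have h := ((hasFDerivAt_gauss x s hz).mul (hasFDerivAt_gauss y t hz)).mul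
    ((((hasFDerivAt_lin y hz).mul (hasFDerivAt_linIm y hz)).const_mul t).sub
      (((hasFDerivAt_lin x hz).mul (hasFDerivAt_linIm x hz)).const_mul s))
  refine (hasDerivAt_im_of_hasFDerivAt h).congr_deriv ?_
  have := Real.pi_pos
  simp [gaussImIm]
  field_simp
  ring

lemma gauss_mul_gauss_le {x y : TraceZero ℝ} {σ : ℝ}
    (hσ : ∀ z : ℂ, σ * gauge z ≤ height x z + height y z) {s t : ℝ} (hs : 1 ≤ s) (ht : 1 ≤ t)
    (z : ℂ) :
    gauss x s z * gauss y t z ≤ Real.exp (-(2 * Real.pi * σ * gauge z)) := by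
  rw [gauss, gauss, ← Real.exp_add]
  apply Real.exp_le_exp.2
  have h1 := mul_le_mul_of_nonneg_left hs (height_nonneg x z)
  have h2 := mul_le_mul_of_nonneg_left ht (height_nonneg y z)
  have h3 := hσ z
  have h4 : σ * gauge z ≤ height x z * s + height y z * t := by linarith
  have := mul_le_mul_of_nonneg_left h4 (show 0 ≤ 2 * Real.pi by positivity)
  linarith

/-- A product of two Gaussians integrates any factor of polynomial growth in the gauge; this serves
the flux and its derivatives alike. -/
lemma integrable_gauss_mul_gauss_mul {x y : TraceZero ℝ} (h : gramDet x y ≠ 0) {s t : ℝ}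
    (hs : 1 ≤ s) (ht : 1 ≤ t) {k : ℂ → ℝ} (hk : Measurable k) (C : ℝ) (n : ℕ)
    (hb : ∀ z : ℂ, z.im ≠ 0 → |k z| ≤ C * gauge z ^ n) :
    Integrable (fun z => gauss x s z * gauss y t z * k z) := by
  obtain ⟨σ, hσ0, hσ⟩ := gauge_le_height_add x y h
  refine integrable_of_le_gauge (C := C) (κ := 2 * Real.pi * σ) ?_ n (by positivity)
    fun z hz => ?_
  · exact (((measurable_gauss x s).mul (measurable_gauss y t)).mul hk).aestronglyMeasurable
  · rw [abs_mul, abs_of_pos (mul_pos (gauss_pos _ _ _) (gauss_pos _ _ _))]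
    calc _ ≤ Real.exp (-(2 * Real.pi * σ * gauge z)) * (C * gauge z ^ n) :=
          mul_le_mul (gauss_mul_gauss_le hσ hs ht z) (hb z hz) (abs_nonneg _) (Real.exp_pos _).le
      _ = _ := by ring

lemma flux_factor_bound (k l m n : ℝ) {s t M Cx Cy : ℝ} (hs : 0 ≤ s)
    (ht : 0 ≤ t) (hk : |k| ≤ Cy * M) (hl : |l| ≤ Cy * M) (hm : |m| ≤ Cx * M)
    (hn : |n| ≤ Cx * M) :
    |t * (k * l) - s * (m * n)| ≤ (t * Cy ^ 2 + s * Cx ^ 2) * M ^ 2 := by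
  have h1 : |k * l| ≤ Cy * M * (Cy * M) := by
    rw [abs_mul]; exact mul_le_mul hk hl (abs_nonneg _) ((abs_nonneg _).trans hk)
  have h2 : |m * n| ≤ Cx * M * (Cx * M) := by
    rw [abs_mul]; exact mul_le_mul hm hn (abs_nonneg _) ((abs_nonneg _).trans hm)
  calc _ ≤ |t * (k * l)| + |s * (m * n)| := abs_sub _ _
    _ = t * |k * l| + s * |m * n| := by
        rw [abs_mul, abs_mul s, abs_of_nonneg hs, abs_of_nonneg ht]
    _ ≤ t * (Cy * M * (Cy * M)) + s * (Cx * M * (Cx * M)) := by gcongr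
    _ = _ := by ring

lemma gramDet_comm (x y : TraceZero ℝ) : gramDet x y = gramDet y x := by
  rw [gramDet, gramDet, pair_eq x y, pair_eq y x]; ring

lemma abs_second_factor_le {a b c t M C : ℝ} (hM : 1 ≤ M) (ht : 0 ≤ t) (ha : |a| ≤ C * M)
    (hb : |b| ≤ C * M) (hc : |a * c| ≤ 3 * C ^ 2 * M ^ 3) :
    |(4 * Real.pi * t * a * b) ^ 2 - 4 * Real.pi * t * (b ^ 2 + a * c)| ≤
      ((4 * Real.pi * t * C ^ 2) ^ 2 + 4 * Real.pi * t * (4 * C ^ 2)) * M ^ 4 := by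
  have hpi := Real.pi_pos
  have hab : |a * b| ≤ C * M * (C * M) := by
    rw [abs_mul]; exact mul_le_mul ha hb (abs_nonneg _) ((abs_nonneg _).trans ha)
  have hb2 : b ^ 2 ≤ (C * M) ^ 2 := sq_le_sq' (abs_le.1 hb).1 (abs_le.1 hb).2
  have h1 : (4 * Real.pi * t * a * b) ^ 2 ≤ (4 * Real.pi * t * C ^ 2) ^ 2 * M ^ 4 := by
    have e := mul_self_le_mul_self (abs_nonneg _) hab
    rw [abs_mul_abs_self] at e
    have := mul_le_mul_of_nonneg_left e (sq_nonneg (4 * Real.pi * t))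
    linarith
  have hM2 : M ^ 2 ≤ M ^ 4 := pow_le_pow_right₀ hM (by norm_num)
  have hM3 : M ^ 3 ≤ M ^ 4 := pow_le_pow_right₀ hM (by norm_num)
  have h2 : |b ^ 2 + a * c| ≤ 4 * C ^ 2 * M ^ 4 := by
    calc _ ≤ |b ^ 2| + |a * c| := abs_add_le _ _
      _ ≤ C ^ 2 * M ^ 2 + 3 * C ^ 2 * M ^ 3 := by
          rw [abs_of_nonneg (sq_nonneg b), ← mul_pow]
          exact add_le_add hb2 hc
      _ ≤ C ^ 2 * M ^ 4 + 3 * C ^ 2 * M ^ 4 := by gcongr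
      _ = _ := by ring
  calc _ ≤ |(4 * Real.pi * t * a * b) ^ 2| + |4 * Real.pi * t * (b ^ 2 + a * c)| := abs_sub _ _
    _ = (4 * Real.pi * t * a * b) ^ 2 + 4 * Real.pi * t * |b ^ 2 + a * c| := by
        rw [abs_of_nonneg (sq_nonneg _), abs_mul,
          abs_of_nonneg (by positivity : 0 ≤ 4 * Real.pi * t)]
    _ ≤ (4 * Real.pi * t * C ^ 2) ^ 2 * M ^ 4 + 4 * Real.pi * t * (4 * C ^ 2 * M ^ 4) := by
        gcongr
    _ = _ := by ring

lemma integrable_gauss_mul_gaussReRe {x y : TraceZero ℝ} (h : gramDet x y ≠ 0) {s t : ℝ}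
    (hs : 1 ≤ s) (ht : 1 ≤ t) : Integrable (fun z => gauss y t z * gaussReRe x s z) := by
  obtain ⟨C, hC, hb⟩ := lin_bounds x
  have m1 := measurable_lin x
  have m2 := measurable_linRe x
  have := integrable_gauss_mul_gauss_mul h hs ht
    (k := fun z => (4 * Real.pi * s * lin x z * linRe x z) ^ 2 -
      4 * Real.pi * s * (linRe x z ^ 2 + lin x z * (x.1 1 0 / z.im))) (by fun_prop) _ 4
    (fun z hz => by
      obtain ⟨b1, b2, b3, b4⟩ := hb z hz
      have h4 := four_le_gauge hz
      refine abs_second_factor_le (by linarith) (by linarith) b1 b2 ?_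
      rw [abs_mul]
      calc _ ≤ C * gauge z * (C * gauge z) :=
            mul_le_mul b1 b4 (abs_nonneg _) ((abs_nonneg _).trans b1)
        _ = C ^ 2 * gauge z ^ 2 := by ring
        _ ≤ 3 * C ^ 2 * gauge z ^ 3 := by
            gcongr
            · nlinarith
            · linarith
            · norm_num)
  refine this.congr (Eventually.of_forall fun z => ?_)
  simp only [gaussReRe]
  ring

lemma integrable_gauss_mul_gaussImIm {x y : TraceZero ℝ} (h : gramDet x y ≠ 0) {s t : ℝ}
    (hs : 1 ≤ s) (ht : 1 ≤ t) : Integrable (fun z => gauss y t z * gaussImIm x s z) := by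
  obtain ⟨C, hC, hb⟩ := lin_bounds x
  have m1 := measurable_lin x
  have m2 := measurable_linIm x
  have := integrable_gauss_mul_gauss_mul h hs ht
    (k := fun z => (4 * Real.pi * s * lin x z * linIm x z) ^ 2 -
      4 * Real.pi * s * (linIm x z ^ 2 + lin x z * (2 * lin x z / z.im ^ 2 - x.1 1 0 / z.im)))
    (by fun_prop) _ 4
    (fun z hz => by
      obtain ⟨b1, b2, b3, b4⟩ := hb z hz
      have h4 := four_le_gauge hz
      refine abs_second_factor_le (by linarith) (by linarith) b1 b3 ?_
      have e : |2 * lin x z / z.im ^ 2| ≤ 2 * C * gauge z ^ 2 := by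
        rw [div_eq_mul_inv, abs_mul, abs_mul, abs_two,
          abs_of_nonneg (by positivity : 0 ≤ (z.im ^ 2)⁻¹)]
        calc _ ≤ 2 * (C * gauge z) * gauge z := by
              have := inv_sq_le_gauge hz
              gcongr
          _ = _ := by ring
      have e2 : |2 * lin x z / z.im ^ 2 - x.1 1 0 / z.im| ≤ 3 * C * gauge z ^ 2 := by
        calc _ ≤ _ := abs_sub _ _
          _ ≤ 2 * C * gauge z ^ 2 + C * gauge z := add_le_add e b4
          _ ≤ 2 * C * gauge z ^ 2 + C * gauge z ^ 2 := by
              gcongr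
              nlinarith
          _ = _ := by ring
      rw [abs_mul]
      calc _ ≤ C * gauge z * (3 * C * gauge z ^ 2) :=
            mul_le_mul b1 e2 (abs_nonneg _) ((abs_nonneg _).trans b1)
        _ = _ := by ring)
  refine this.congr (Eventually.of_forall fun z => ?_)
  simp only [gaussImIm]
  ring

lemma integrable_fluxRe {x y : TraceZero ℝ} (h : gramDet x y ≠ 0) {s t : ℝ}
    (hs : 1 ≤ s) (ht : 1 ≤ t) : Integrable (fluxRe x y s t) := by
  obtain ⟨Cx, hCx, hbx⟩ := lin_bounds x
  obtain ⟨Cy, hCy, hby⟩ := lin_bounds y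
  have m1 := measurable_lin x
  have m2 := measurable_linRe x
  have m3 := measurable_lin y
  have m4 := measurable_linRe y
  exact integrable_gauss_mul_gauss_mul h hs ht (by fun_prop) _ 2 fun z hz =>
    flux_factor_bound _ _ _ _ (by linarith) (by linarith) (hby z hz).1 (hby z hz).2.1
      (hbx z hz).1 (hbx z hz).2.1

lemma integrable_fluxIm {x y : TraceZero ℝ} (h : gramDet x y ≠ 0) {s t : ℝ}
    (hs : 1 ≤ s) (ht : 1 ≤ t) : Integrable (fluxIm x y s t) := by
  obtain ⟨Cx, hCx, hbx⟩ := lin_bounds x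
  obtain ⟨Cy, hCy, hby⟩ := lin_bounds y
  have m1 := measurable_lin x
  have m2 := measurable_linIm x
  have m3 := measurable_lin y
  have m4 := measurable_linIm y
  exact integrable_gauss_mul_gauss_mul h hs ht (by fun_prop) _ 2 fun z hz =>
    flux_factor_bound _ _ _ _ (by linarith) (by linarith) (hby z hz).1 (hby z hz).2.2.1
      (hbx z hz).1 (hbx z hz).2.2.1

/-- The Gaussians are exponentially small at the real axis, so the flux extended by zero is `O(v²)`
there. No boundary term arises from joining the two half planes. -/
lemma hasDerivAt_fluxIm_of_im_eq_zero {x y : TraceZero ℝ} (h : gramDet x y ≠ 0) {s t : ℝ}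
    (hs : 1 ≤ s) (ht : 1 ≤ t) {z : ℂ} (hz : z.im = 0) :
    HasDerivAt (fun v : ℝ => fluxIm x y s t ⟨z.re, v⟩) 0 z.im := by
  obtain ⟨Cx, hCx, hbx⟩ := lin_bounds x
  obtain ⟨Cy, hCy, hby⟩ := lin_bounds y
  obtain ⟨σ, hσ0, hσ⟩ := gauge_le_height_add x y h
  obtain ⟨K, hK, hKb⟩ := pow_mul_exp_neg_le 3 (show 0 < 2 * Real.pi * σ by positivity)
  set L := t * Cy ^ 2 + s * Cx ^ 2 with hL
  have hL0 : 0 < L := by positivity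
  have hbig : (fun v : ℝ => fluxIm x y s t ⟨z.re, v⟩) =O[𝓝 z.im] fun v => ‖v - z.im‖ ^ 2 := by
    refine Asymptotics.IsBigO.of_bound (L * K) (Eventually.of_forall fun v => ?_)
    rw [hz, sub_zero, norm_pow, norm_norm]
    rcases eq_or_ne v 0 with rfl | hv
    · simp [fluxIm, lin]
    set w : ℂ := ⟨z.re, v⟩ with hw
    have hwv : w.im ≠ 0 := hv
    have h4 := four_le_gauge hwv
    have h1 : |fluxIm x y s t w| ≤
        Real.exp (-(2 * Real.pi * σ * gauge w)) * (L * gauge w ^ 2) := by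
      rw [fluxIm, abs_mul, abs_of_pos (mul_pos (gauss_pos _ _ _) (gauss_pos _ _ _))]
      exact mul_le_mul (gauss_mul_gauss_le hσ hs ht w)
        (flux_factor_bound _ _ _ _ (by linarith) (by linarith) (hby w hwv).1 (hby w hwv).2.2.1
          (hbx w hwv).1 (hbx w hwv).2.2.1) (abs_nonneg _) (Real.exp_pos _).le
    -- This buys the factor `v²` for one more power of the gauge, which the exponential still
    -- absorbs; hence the exponent `3` in `hKb`.
    have h2 : 1 ≤ gauge w * v ^ 2 := by
      have := inv_sq_le_gauge hwv
      rw [inv_eq_one_div, div_le_iff₀ (by positivity)] at this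
      exact this
    have h3 := hKb (gauge w) (by linarith)
    rw [Real.norm_eq_abs, Real.norm_eq_abs, sq_abs]
    calc _ ≤ _ := h1
      _ = Real.exp (-(2 * Real.pi * σ * gauge w)) * (L * gauge w ^ 2) * 1 := by ring
      _ ≤ Real.exp (-(2 * Real.pi * σ * gauge w)) * (L * gauge w ^ 2) * (gauge w * v ^ 2) := by
          gcongr
      _ = L * (gauge w ^ 3 * Real.exp (-(2 * Real.pi * σ * gauge w))) * v ^ 2 := by ring
      _ ≤ _ := by gcongr
  simpa using (hbig.hasFDerivAt (by norm_num)).hasDerivAt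

/-- Green's formula for two Gaussians whose vectors span a nondegenerate plane. -/
lemma integral_green {x y : TraceZero ℝ} (h : gramDet x y ≠ 0) {s t : ℝ}
    (hs : 1 ≤ s) (ht : 1 ≤ t) :
    ∫ z, (gauss y t z * ddcGauss x s z - gauss x s z * ddcGauss y t z) = 0 := by
  have h' : gramDet y x ≠ 0 := by rwa [gramDet_comm]
  have iRe := ((integrable_gauss_mul_gaussReRe h hs ht).sub
    (integrable_gauss_mul_gaussReRe h' ht hs)).const_mul (4 * Real.pi)⁻¹
  have iIm := ((integrable_gauss_mul_gaussImIm h hs ht).sub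
    (integrable_gauss_mul_gaussImIm h' ht hs)).const_mul (4 * Real.pi)⁻¹
  simp only [Pi.sub_apply] at iRe iIm
  have e1 := integral_deriv_re_eq_zero (integrable_fluxRe h hs ht) iRe
    (hasDerivAt_fluxRe x y s t)
  -- The conventions for division by zero do not make `gaussImIm` vanish on the real axis, so the
  -- derivative is corrected to `0` on this null set.
  set W : ℂ → ℝ := fun z => if z.im = 0 then 0 else
    (4 * Real.pi)⁻¹ * (gauss y t z * gaussImIm x s z - gauss x s z * gaussImIm y t z) with hW
  have hWae : W =ᵐ[volume] fun z =>
      (4 * Real.pi)⁻¹ * (gauss y t z * gaussImIm x s z - gauss x s z * gaussImIm y t z) := by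
    filter_upwards [ae_im_ne_zero] with z hz
    simp [hW, hz]
  have e2 := integral_deriv_im_eq_zero (integrable_fluxIm h hs ht) (iIm.congr hWae.symm)
    (fun z => by
      rcases eq_or_ne z.im 0 with hz | hz
      · have hw0 : W z = 0 := by simp [hW, hz]
        rw [hw0]
        exact hasDerivAt_fluxIm_of_im_eq_zero h hs ht hz
      · simp only [hW, hz, if_false]
        exact hasDerivAt_fluxIm x y s t hz)
  rw [integral_congr_ae hWae] at e2
  have e3 := integral_add iRe iIm
  rw [e1, e2, add_zero] at e3
  rw [← e3]
  refine integral_congr_ae ?_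
  filter_upwards [ae_im_ne_zero] with z hz
  have a1 := gaussReRe_add_gaussImIm x s hz
  have a2 := gaussReRe_add_gaussImIm y t hz
  have := Real.pi_pos
  have a3 : ddcGauss x s z = (4 * Real.pi)⁻¹ * (gaussReRe x s z + gaussImIm x s z) := by
    rw [a1]; field_simp
  have a4 : ddcGauss y t z = (4 * Real.pi)⁻¹ * (gaussReRe y t z + gaussImIm y t z) := by
    rw [a2]; field_simp
  rw [a3, a4]
  ring

/-! ### The truncated Green function and the symmetric formula. -/

lemma integrable_uncurry_of_le {F : ℝ → ℂ → ℝ} {a b : ℝ} {g : ℂ → ℝ}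
    (hm : AEStronglyMeasurable (Function.uncurry F)
      (((volume : Measure ℝ).restrict (Set.Ioc a b)).prod (volume : Measure ℂ)))
    (hg : Integrable g) (hb : ∀ t ∈ Set.Ioc a b, ∀ z : ℂ, z.im ≠ 0 → |F t z| ≤ g z) :
    Integrable (Function.uncurry F)
      (((volume : Measure ℝ).restrict (Set.Ioc a b)).prod (volume : Measure ℂ)) := by
  refine Integrable.mono' (hg.comp_snd (volume.restrict (Set.Ioc a b))) hm ?_
  have h1 := (Measure.quasiMeasurePreserving_fst
    (μ := (volume : Measure ℝ).restrict (Set.Ioc a b)) (ν := (volume : Measure ℂ))).ae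
    (ae_restrict_mem measurableSet_Ioc)
  have h2 := (Measure.quasiMeasurePreserving_snd
    (μ := (volume : Measure ℝ).restrict (Set.Ioc a b)) (ν := (volume : Measure ℂ))).ae
    ae_im_ne_zero
  filter_upwards [h1, h2] with p hp1 hp2
  exact hb p.1 hp1 p.2 hp2

lemma integral_intervalIntegral_swap {F : ℝ → ℂ → ℝ} {a b : ℝ} (hab : a ≤ b)
    (hF : Integrable (Function.uncurry F)
      (((volume : Measure ℝ).restrict (Set.Ioc a b)).prod (volume : Measure ℂ))) :
    ∫ z, ∫ t in a..b, F t z = ∫ t in a..b, ∫ z, F t z := by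
  simp only [intervalIntegral.integral_of_le hab]
  exact (integral_integral_swap hF).symm

lemma integrable_intervalIntegral {F : ℝ → ℂ → ℝ} {a b : ℝ} (hab : a ≤ b)
    (hF : Integrable (Function.uncurry F)
      (((volume : Measure ℝ).restrict (Set.Ioc a b)).prod (volume : Measure ℂ))) :
    Integrable fun z => ∫ t in a..b, F t z := by
  simp only [intervalIntegral.integral_of_le hab]
  exact hF.integral_prod_right

/-- The truncation of the Green function `ξ(x)`. -/
def truncXi (x : TraceZero ℝ) (T : ℝ) (z : ℂ) : ℝ := truncBeta (2 * Real.pi * height x z) T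

lemma truncXi_eq_integral (x : TraceZero ℝ) (T : ℝ) (z : ℂ) :
    truncXi x T z = ∫ s in (1 : ℝ)..T, gauss x s z * s⁻¹ := rfl

lemma truncXi_nonneg (x : TraceZero ℝ) {T : ℝ} (hT : 1 ≤ T) (z : ℂ) : 0 ≤ truncXi x T z :=
  truncBeta_nonneg _ hT

lemma truncXi_le (x : TraceZero ℝ) {T : ℝ} (hT : 1 ≤ T) (z : ℂ) :
    truncXi x T z ≤ gauss x 1 z * T := by
  have := truncBeta_le (r := 2 * Real.pi * height x z)
    (by have := height_nonneg x z; positivity) hT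
  rwa [gauss, mul_one]

lemma hasDerivAt_gauss (x : TraceZero ℝ) (t : ℝ) (z : ℂ) :
    HasDerivAt (fun t => gauss x t z) (gauss x t z * -(2 * Real.pi * height x z)) t := by
  have h := ((hasDerivAt_id t).const_mul (-(2 * Real.pi * height x z))).exp
  refine h.congr_deriv ?_
  simp [gauss]

/-- This is `dd^c` applied to `∂ₜ ξ(√t x) = -g_x(t)/t`, checked here directly on the explicit
densities. -/
lemma hasDerivAt_omega (x : TraceZero ℝ) {t : ℝ} (ht : t ≠ 0) (z : ℂ) :
    HasDerivAt (fun t => omega x t z) (-(ddcGauss x t z * t⁻¹)) t := by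
  have h := ((hasDerivAt_gauss x t z).mul ((((hasDerivAt_id t).const_mul 2).mul_const
    (height x z + qnorm x)).sub_const ((2 * Real.pi)⁻¹))).div_const (z.im ^ 2)
  refine h.congr_deriv ?_
  have := Real.pi_pos
  simp only [ddcGauss, id]
  rw [div_mul_eq_mul_div, ← neg_div]
  congr 1
  field_simp
  ring

lemma continuous_gauss_left (x : TraceZero ℝ) (z : ℂ) : Continuous fun t => gauss x t z := by
  unfold gauss; fun_prop

lemma continuous_omega_left (x : TraceZero ℝ) (z : ℂ) : Continuous fun t => omega x t z := by
  have := continuous_gauss_left x z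
  unfold omega; fun_prop

lemma continuous_ddcGauss_left (x : TraceZero ℝ) (z : ℂ) :
    Continuous fun t => ddcGauss x t z := by
  have := continuous_gauss_left x z
  unfold ddcGauss; fun_prop

lemma continuousOn_inv_uIcc {T : ℝ} (hT : 1 ≤ T) :
    ContinuousOn (fun s : ℝ => s⁻¹) (Set.uIcc 1 T) := by
  refine continuousOn_id.inv₀ fun s hs => ?_
  rw [Set.uIcc_of_le hT] at hs
  exact (one_pos.trans_le hs.1).ne'

lemma hasDerivAt_truncXi (x : TraceZero ℝ) {t : ℝ} (ht : 1 ≤ t) (z : ℂ) :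
    HasDerivAt (fun t => truncXi x t z) (gauss x t z * t⁻¹) t := by
  have ht0 : t ≠ 0 := (one_pos.trans_le ht).ne'
  refine intervalIntegral.integral_hasDerivAt_right
    ((((continuous_gauss_left x z).continuousOn).mul
      (continuousOn_inv_uIcc ht)).intervalIntegrable) ?_ ?_
  · refine ⟨Set.univ, univ_mem, ?_⟩
    have := (continuous_gauss_left x z).measurable
    exact (by fun_prop : Measurable fun s => gauss x s z * s⁻¹).aestronglyMeasurable
  · exact ((continuous_gauss_left x z).continuousAt).mul (continuousAt_inv₀ ht0)

lemma truncXi_one (x : TraceZero ℝ) (z : ℂ) : truncXi x 1 z = 0 := by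
  simp [truncXi, truncBeta]

/-- The integrand of Green's formula, with the weight of the two scaling parameters. -/
def greenKernel (x y : TraceZero ℝ) (s t : ℝ) (z : ℂ) : ℝ :=
  (gauss y t z * ddcGauss x s z - gauss x s z * ddcGauss y t z) * (s⁻¹ * t⁻¹)

/-- The `dd^c g_x` term integrates in `s` to a difference of values of `omega` by
`hasDerivAt_omega`; the `g_x` term integrates to `truncXi`. The upper limit is `t`, so that the
second integration runs over a triangle. -/
lemma integral_greenKernel_left (x y : TraceZero ℝ) {t : ℝ} (ht : 1 ≤ t) (z : ℂ) :
    ∫ s in (1 : ℝ)..t, greenKernel x y s t z =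
      gauss y t z * t⁻¹ * (omega x 1 z - omega x t z) -
        truncXi x t z * (ddcGauss y t z * t⁻¹) := by
  have c1 : ContinuousOn (fun s => ddcGauss x s z * s⁻¹) (Set.uIcc 1 t) :=
    (continuous_ddcGauss_left x z).continuousOn.mul (continuousOn_inv_uIcc ht)
  have c2 : ContinuousOn (fun s => gauss x s z * s⁻¹) (Set.uIcc 1 t) :=
    (continuous_gauss_left x z).continuousOn.mul (continuousOn_inv_uIcc ht)
  have e1 : ∫ s in (1 : ℝ)..t, -(ddcGauss x s z * s⁻¹) = omega x t z - omega x 1 z := by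
    refine intervalIntegral.integral_eq_sub_of_hasDerivAt (f := fun s => omega x s z)
      (fun s hs => hasDerivAt_omega x ?_ z) c1.neg.intervalIntegrable
    rw [Set.uIcc_of_le ht] at hs
    exact (one_pos.trans_le hs.1).ne'
  rw [intervalIntegral.integral_neg] at e1
  have e2 : (fun s => greenKernel x y s t z) = fun s =>
      gauss y t z * t⁻¹ * (ddcGauss x s z * s⁻¹) - ddcGauss y t z * t⁻¹ * (gauss x s z * s⁻¹) := by
    ext s; rw [greenKernel]; ring
  rw [e2, intervalIntegral.integral_sub (c1.intervalIntegrable.const_mul _)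
    (c2.intervalIntegrable.const_mul _), intervalIntegral.integral_const_mul,
    intervalIntegral.integral_const_mul, ← truncXi_eq_integral]
  linear_combination (-(gauss y t z * t⁻¹)) * e1

/-- The integrand of the manifestly symmetric expression for the star product. -/
def symKernel (x y : TraceZero ℝ) (t : ℝ) (z : ℂ) : ℝ :=
  (gauss y t z * omega x t z + gauss x t z * omega y t z) * t⁻¹

lemma integral_integral_greenKernel (x y : TraceZero ℝ) {T : ℝ} (hT : 1 ≤ T) (z : ℂ) :
    ∫ t in (1 : ℝ)..T, ∫ s in (1 : ℝ)..t, greenKernel x y s t z =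
      (truncXi y T z * omega x 1 z + truncXi x T z * omega y T z) -
        ∫ t in (1 : ℝ)..T, symKernel x y t z := by
  have hci := continuousOn_inv_uIcc hT
  have cx := (continuous_gauss_left x z).continuousOn (s := Set.uIcc 1 T)
  have cy := (continuous_gauss_left y z).continuousOn (s := Set.uIcc 1 T)
  have ox := (continuous_omega_left x z).continuousOn (s := Set.uIcc 1 T)
  have oy := (continuous_omega_left y z).continuousOn (s := Set.uIcc 1 T)
  have dy := (continuous_ddcGauss_left y z).continuousOn (s := Set.uIcc 1 T)
  have tx : ContinuousOn (fun t => truncXi x t z) (Set.uIcc 1 T) := fun t ht => by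
    rw [Set.uIcc_of_le hT] at ht
    exact (hasDerivAt_truncXi x ht.1 z).continuousAt.continuousWithinAt
  have c1 : ContinuousOn (fun t => gauss y t z * t⁻¹ * omega x 1 z +
      (gauss x t z * t⁻¹ * omega y t z + truncXi x t z * -(ddcGauss y t z * t⁻¹)))
      (Set.uIcc 1 T) := by fun_prop
  have c2 : ContinuousOn (fun t => symKernel x y t z) (Set.uIcc 1 T) := by
    unfold symKernel; fun_prop
  -- The derivative of this primitive is the inner integral plus `symKernel`; its value at `1` is
  -- zero because the truncated Green functions vanish there.
  have e1 := intervalIntegral.integral_eq_sub_of_hasDerivAt (a := 1) (b := T)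
    (f := fun t => truncXi y t z * omega x 1 z + truncXi x t z * omega y t z)
    (fun t ht => by
      rw [Set.uIcc_of_le hT] at ht
      exact ((hasDerivAt_truncXi y ht.1 z).mul_const _).add ((hasDerivAt_truncXi x ht.1 z).mul
        (hasDerivAt_omega y (one_pos.trans_le ht.1).ne' z))) c1.intervalIntegrable
  simp only [truncXi_one, zero_mul, add_zero, sub_zero] at e1
  rw [← e1, ← intervalIntegral.integral_sub c1.intervalIntegrable c2.intervalIntegrable]
  refine intervalIntegral.integral_congr fun t ht => ?_
  rw [Set.uIcc_of_le hT] at ht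
  simp only [integral_greenKernel_left x y ht.1, symKernel]
  ring

lemma height_bounds (x : TraceZero ℝ) : ∃ C, 0 < C ∧ |qnorm x| ≤ C ∧ ∀ z : ℂ, z.im ≠ 0 →
    height x z ≤ C * gauge z ∧ height x z + qnorm x ≤ 2 * C * gauge z := by
  obtain ⟨C, hC, hb⟩ := height_le_gauge x
  have h0 := abs_nonneg (qnorm x)
  refine ⟨C + |qnorm x|, by positivity, by linarith, fun z hz => ?_⟩
  have h4 := four_le_gauge hz
  have h1 := hb z
  have h2 := le_abs_self (qnorm x)
  constructor <;> nlinarith [mul_nonneg h0 (by linarith : 0 ≤ gauge z - 1)]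

lemma abs_omega_le (x : TraceZero ℝ) : ∃ C, 0 < C ∧ ∀ t T : ℝ, 1 ≤ t → t ≤ T → ∀ z : ℂ,
    z.im ≠ 0 → |omega x t z| ≤ gauss x t z * (C * T * gauge z ^ 2) := by
  obtain ⟨C, hC, -, hb⟩ := height_bounds x
  refine ⟨4 * C + 1, by positivity, fun t T ht htT z hz => ?_⟩
  have h4 := four_le_gauge hz
  have hT : 0 < T := by linarith
  have hl := height_add_qnorm_nonneg x hz
  have hpi : (2 * Real.pi)⁻¹ ≤ 1 :=
    inv_le_one_of_one_le₀ (by linarith [Real.pi_gt_three])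
  have hpi0 : 0 ≤ (2 * Real.pi)⁻¹ := by positivity
  have h1 : |2 * t * (height x z + qnorm x) - (2 * Real.pi)⁻¹| ≤ (4 * C + 1) * T * gauge z := by
    have a1 : 2 * t * (height x z + qnorm x) ≤ 2 * T * (2 * C * gauge z) := by
      have := (hb z hz).2
      gcongr
    have a0 : 0 ≤ 2 * t * (height x z + qnorm x) := by positivity
    have a2 : 1 ≤ T * gauge z := by nlinarith
    rw [abs_le]
    constructor <;> nlinarith
  rw [omega, abs_div, abs_mul, abs_of_pos (gauss_pos x t z), mul_div_assoc,
    abs_of_nonneg (sq_nonneg z.im), div_eq_mul_inv]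
  refine mul_le_mul_of_nonneg_left ?_ (gauss_pos x t z).le
  calc _ ≤ (4 * C + 1) * T * gauge z * gauge z :=
        mul_le_mul h1 (inv_sq_le_gauge hz) (by positivity) (by positivity)
    _ = _ := by ring

lemma abs_ddcGauss_le (x : TraceZero ℝ) : ∃ C, 0 < C ∧ ∀ t T : ℝ, 1 ≤ t → t ≤ T → ∀ z : ℂ,
    z.im ≠ 0 → |ddcGauss x t z| ≤ gauss x t z * (C * T ^ 2 * gauge z ^ 3) := by
  obtain ⟨C, hC, hq, hb⟩ := height_bounds x
  refine ⟨5 * C + 8 * Real.pi * C ^ 2, by positivity, fun t T ht htT z hz => ?_⟩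
  have h4 := four_le_gauge hz
  have hl := height_add_qnorm_nonneg x hz
  have hR := height_nonneg x z
  have hpi := Real.pi_pos
  obtain ⟨b1, b2⟩ := hb z hz
  have hT : 1 ≤ T := ht.trans htT
  have hTT : T ≤ T ^ 2 := by nlinarith
  have hMM : gauge z ≤ gauge z ^ 2 := by nlinarith
  have h1 : |-3 * t * height x z - 2 * t * qnorm x +
      4 * Real.pi * t ^ 2 * height x z * (height x z + qnorm x)| ≤
      (5 * C + 8 * Real.pi * C ^ 2) * T ^ 2 * gauge z ^ 2 := by
    calc _ ≤ |-3 * t * height x z - 2 * t * qnorm x| +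
          |4 * Real.pi * t ^ 2 * height x z * (height x z + qnorm x)| := abs_add_le _ _
      _ ≤ (|-3 * t * height x z| + |2 * t * qnorm x|) +
          |4 * Real.pi * t ^ 2 * height x z * (height x z + qnorm x)| := by
          gcongr
          exact abs_sub _ _
      _ = (3 * t * height x z + 2 * t * |qnorm x|) +
          4 * Real.pi * t ^ 2 * height x z * (height x z + qnorm x) := by
          rw [abs_of_nonneg (by positivity : 0 ≤ 4 * Real.pi * t ^ 2 * height x z *
            (height x z + qnorm x)), abs_mul (2 * t), abs_of_nonneg (by positivity : 0 ≤ 2 * t),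
            abs_mul, abs_of_nonneg hR, abs_of_nonpos (by linarith : -3 * t ≤ 0)]
          ring
      _ ≤ (3 * T ^ 2 * (C * gauge z ^ 2) + 2 * T ^ 2 * (C * gauge z ^ 2)) +
          4 * Real.pi * T ^ 2 * (C * gauge z) * (2 * C * gauge z) := by
          have c1 : t ≤ T ^ 2 := htT.trans hTT
          have c2 : height x z ≤ C * gauge z ^ 2 := b1.trans (by gcongr)
          have c3 : |qnorm x| ≤ C * gauge z ^ 2 := hq.trans (by nlinarith)
          gcongr
      _ = _ := by ring
  rw [ddcGauss, abs_div, abs_mul, abs_of_pos (gauss_pos x t z), mul_div_assoc,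
    abs_of_nonneg (sq_nonneg z.im), div_eq_mul_inv]
  refine mul_le_mul_of_nonneg_left ?_ (gauss_pos x t z).le
  calc _ ≤ (5 * C + 8 * Real.pi * C ^ 2) * T ^ 2 * gauge z ^ 2 * gauge z :=
        mul_le_mul h1 (inv_sq_le_gauge hz) (by positivity) (by positivity)
    _ = _ := by ring

lemma abs_greenKernel_le {x y : TraceZero ℝ} (h : gramDet x y ≠ 0) (T : ℝ) :
    ∃ C κ : ℝ, 0 < κ ∧ 0 ≤ C ∧ ∀ s t : ℝ, 1 ≤ s → s ≤ T → 1 ≤ t → t ≤ T → ∀ z : ℂ, z.im ≠ 0 →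
      |greenKernel x y s t z| ≤ C * Real.exp (-κ * ‖z‖ ^ 2) := by
  obtain ⟨Cx, hCx, hbx⟩ := abs_ddcGauss_le x
  obtain ⟨Cy, hCy, hby⟩ := abs_ddcGauss_le y
  obtain ⟨σ, hσ0, hσ⟩ := gauge_le_height_add x y h
  obtain ⟨K, hK, hKb⟩ := gauge_pow_mul_exp_le 3 (show 0 < 2 * Real.pi * σ by positivity)
  refine ⟨(Cx + Cy) * T ^ 2 * K, 2 * Real.pi * σ / 2, by positivity, by positivity,
    fun s t hs hsT ht htT z hz => ?_⟩
  have b1 := hbx s T hs hsT z hz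
  have b2 := hby t T ht htT z hz
  have gx := gauss_pos x s z
  have gy := gauss_pos y t z
  have hw : s⁻¹ * t⁻¹ ≤ 1 := mul_le_one₀ (inv_le_one_of_one_le₀ hs) (by positivity)
    (inv_le_one_of_one_le₀ ht)
  have hw0 : 0 ≤ s⁻¹ * t⁻¹ := by positivity
  have h4 := four_le_gauge hz
  rw [greenKernel, abs_mul, abs_of_nonneg hw0]
  calc _ ≤ |gauss y t z * ddcGauss x s z - gauss x s z * ddcGauss y t z| * 1 := by gcongr
    _ ≤ (|gauss y t z * ddcGauss x s z| + |gauss x s z * ddcGauss y t z|) * 1 := by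
        gcongr
        exact abs_sub _ _
    _ = gauss y t z * |ddcGauss x s z| + gauss x s z * |ddcGauss y t z| := by
        rw [abs_mul, abs_mul, abs_of_pos gx, abs_of_pos gy, mul_one]
    _ ≤ gauss y t z * (gauss x s z * (Cx * T ^ 2 * gauge z ^ 3)) +
          gauss x s z * (gauss y t z * (Cy * T ^ 2 * gauge z ^ 3)) := by gcongr
    _ = (Cx + Cy) * T ^ 2 * (gauge z ^ 3 * (gauss x s z * gauss y t z)) := by ring
    _ ≤ (Cx + Cy) * T ^ 2 * (gauge z ^ 3 * Real.exp (-(2 * Real.pi * σ * gauge z))) := by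
        gcongr
        exact gauss_mul_gauss_le hσ hs ht z
    _ ≤ (Cx + Cy) * T ^ 2 * (K * Real.exp (-(2 * Real.pi * σ / 2) * ‖z‖ ^ 2)) := by
        gcongr _ * ?_
        exact hKb z hz
    _ = _ := by ring

lemma measurable_greenKernel (x y : TraceZero ℝ) :
    Measurable fun p : (ℝ × ℂ) × ℝ => greenKernel x y p.2 p.1.1 p.1.2 := by
  have hx := measurable_height x
  have hy := measurable_height y
  unfold greenKernel ddcGauss gauss
  fun_prop

/-- Moves the variable endpoint into the integrand, so that joint measurability in `(t, z)` follows
from the theorem for a fixed measure. -/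
lemma intervalIntegral_greenKernel_eq (x y : TraceZero ℝ) {t : ℝ} (ht : 1 ≤ t) (z : ℂ) :
    ∫ s in (1 : ℝ)..t, greenKernel x y s t z =
      ∫ s in Set.Ioi (1 : ℝ), if s ≤ t then greenKernel x y s t z else 0 := by
  have : (fun s : ℝ => if s ≤ t then greenKernel x y s t z else 0) =
      Set.indicator (Set.Iic t) fun s => greenKernel x y s t z := by
    ext s; simp [Set.indicator_apply]
  rw [this, setIntegral_indicator measurableSet_Iic, Set.Ioi_inter_Iic,
    intervalIntegral.integral_of_le ht]

lemma aestronglyMeasurable_integral_greenKernel (x y : TraceZero ℝ) (T : ℝ) :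
    AEStronglyMeasurable
      (Function.uncurry fun (t : ℝ) (z : ℂ) => ∫ s in (1 : ℝ)..t, greenKernel x y s t z)
      (((volume : Measure ℝ).restrict (Set.Ioc 1 T)).prod (volume : Measure ℂ)) := by
  have hm : Measurable fun p : (ℝ × ℂ) × ℝ =>
      if p.2 ≤ p.1.1 then greenKernel x y p.2 p.1.1 p.1.2 else 0 :=
    Measurable.ite (measurableSet_le measurable_snd measurable_fst.fst)
      (measurable_greenKernel x y) measurable_const
  have hs := StronglyMeasurable.integral_prod_right'
    (ν := (volume : Measure ℝ).restrict (Set.Ioi 1)) hm.stronglyMeasurable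
  refine hs.aestronglyMeasurable.congr ?_
  have h1 := (Measure.quasiMeasurePreserving_fst
    (μ := (volume : Measure ℝ).restrict (Set.Ioc 1 T)) (ν := (volume : Measure ℂ))).ae
    (ae_restrict_mem measurableSet_Ioc)
  filter_upwards [h1] with p hp
  exact (intervalIntegral_greenKernel_eq x y hp.1.le p.2).symm

lemma measurable_omega (x : TraceZero ℝ) (t : ℝ) : Measurable (omega x t) := by
  have := measurable_height x
  unfold omega gauss
  fun_prop

lemma measurable_truncXi (x : TraceZero ℝ) {T : ℝ} (hT : 1 ≤ T) : Measurable (truncXi x T) := by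
  have := measurable_height x
  have h : StronglyMeasurable fun z : ℂ => ∫ s, gauss x s z * s⁻¹
      ∂(volume.restrict (Set.Ioc (1 : ℝ) T)) :=
    StronglyMeasurable.integral_prod_right'
      (f := fun p : ℂ × ℝ => gauss x p.2 p.1 * p.2⁻¹)
      (by unfold gauss; fun_prop : Measurable fun p : ℂ × ℝ =>
        gauss x p.2 p.1 * p.2⁻¹).stronglyMeasurable
  have e : truncXi x T = fun z : ℂ => ∫ s, gauss x s z * s⁻¹
      ∂(volume.restrict (Set.Ioc (1 : ℝ) T)) := by
    ext z
    rw [truncXi_eq_integral, intervalIntegral.integral_of_le hT]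
  rw [e]
  exact h.measurable

lemma integrable_truncXi_mul_omega {x y : TraceZero ℝ} (h : gramDet x y ≠ 0) {S T : ℝ}
    (hS : 1 ≤ S) (hT : 1 ≤ T) : Integrable fun z => truncXi x T z * omega y S z := by
  obtain ⟨C, hC, hb⟩ := abs_omega_le y
  obtain ⟨σ, hσ0, hσ⟩ := gauge_le_height_add x y h
  refine integrable_of_le_gauge (C := C * S * T) (κ := 2 * Real.pi * σ) ?_ 2 (by positivity)
    fun z hz => ?_
  · exact ((measurable_truncXi x hT).mul (measurable_omega y S)).aestronglyMeasurable
  · have h0 := truncXi_nonneg x hT z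
    have h1 := truncXi_le x hT z
    have h2 := hb S S hS le_rfl z hz
    have h4 := four_le_gauge hz
    have gx := gauss_pos x 1 z
    rw [abs_mul, abs_of_nonneg h0]
    calc _ ≤ (gauss x 1 z * T) * (gauss y S z * (C * S * gauge z ^ 2)) := by gcongr
      _ = C * S * T * (gauge z ^ 2 * (gauss x 1 z * gauss y S z)) := by ring
      _ ≤ _ := by
        gcongr
        exact gauss_mul_gauss_le hσ le_rfl hS z

/-- The truncated star product is given by a manifestly symmetric integral. -/
lemma integral_truncXi_add {x y : TraceZero ℝ} (h : gramDet x y ≠ 0) {T : ℝ} (hT : 1 ≤ T) :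
    (∫ z, truncXi y T z * omega x 1 z) + ∫ z, truncXi x T z * omega y T z =
      ∫ z, ∫ t in (1 : ℝ)..T, symKernel x y t z := by
  obtain ⟨C, κ, hκ, hC, hb⟩ := abs_greenKernel_le h T
  have hg := (integrable_exp_neg_norm_sq hκ).const_mul C
  have hF1 : ∀ t ∈ Set.Icc 1 T, Integrable
      (Function.uncurry fun (s : ℝ) (z : ℂ) => greenKernel x y s t z)
      (((volume : Measure ℝ).restrict (Set.Ioc 1 t)).prod (volume : Measure ℂ)) := fun t ht => by
    refine integrable_uncurry_of_le ?_ hg fun s hs z hz =>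
      hb s t hs.1.le (hs.2.trans ht.2) ht.1 ht.2 z hz
    exact ((measurable_greenKernel x y).comp (by fun_prop :
      Measurable fun p : ℝ × ℂ => (((t, p.2), p.1) : (ℝ × ℂ) × ℝ))).aestronglyMeasurable
  have hF2 : Integrable
      (Function.uncurry fun (t : ℝ) (z : ℂ) => ∫ s in (1 : ℝ)..t, greenKernel x y s t z)
      (((volume : Measure ℝ).restrict (Set.Ioc 1 T)).prod (volume : Measure ℂ)) := by
    refine integrable_uncurry_of_le (aestronglyMeasurable_integral_greenKernel x y T)
      (hg.const_mul (T - 1)) fun t ht z hz => ?_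
    have h1 : ‖∫ s in (1 : ℝ)..t, greenKernel x y s t z‖ ≤
        C * Real.exp (-κ * ‖z‖ ^ 2) * |t - 1| := by
      refine intervalIntegral.norm_integral_le_of_norm_le_const fun s hs => ?_
      rw [Set.uIoc_of_le ht.1.le] at hs
      exact hb s t hs.1.le (hs.2.trans ht.2) ht.1.le ht.2 z hz
    rw [abs_of_nonneg (by linarith [ht.1])] at h1
    refine h1.trans ?_
    rw [mul_comm]
    gcongr
    exact ht.2
  -- Fubini twice brings the integral over the plane inside, where Green's formula annihilates it
  -- for each `s` and `t`.
  have hE : ∫ z, ∫ t in (1 : ℝ)..T, ∫ s in (1 : ℝ)..t, greenKernel x y s t z = 0 := by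
    rw [integral_intervalIntegral_swap hT hF2]
    have : ∀ t ∈ Set.uIcc 1 T, ∫ z, ∫ s in (1 : ℝ)..t, greenKernel x y s t z = (0 : ℝ) := by
      intro t ht
      rw [Set.uIcc_of_le hT] at ht
      rw [integral_intervalIntegral_swap ht.1 (hF1 t ht)]
      have : ∀ s ∈ Set.uIcc 1 t, ∫ z, greenKernel x y s t z = (0 : ℝ) := by
        intro s hs
        rw [Set.uIcc_of_le ht.1] at hs
        simp only [greenKernel]
        rw [integral_mul_const, integral_green h hs.1 ht.1, zero_mul]
      rw [intervalIntegral.integral_congr this]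
      simp
    rw [intervalIntegral.integral_congr this]
    simp
  have hEi := integrable_intervalIntegral hT hF2
  have i1 := integrable_truncXi_mul_omega (by rwa [gramDet_comm] : gramDet y x ≠ 0) le_rfl hT
  have i2 := integrable_truncXi_mul_omega h hT hT
  have e := integral_sub (i1.add i2) hEi
  simp only [Pi.add_apply] at e
  rw [hE, sub_zero] at e
  rw [← integral_add i1 i2, ← e]
  refine integral_congr_ae (Eventually.of_forall fun z => ?_)
  simp only [integral_integral_greenKernel x y hT]
  ring

/-! ### Zeros of the height and integrability of the singularities. -/

lemma coe_ne_zero_of_gramDet {x y : TraceZero ℝ} (h : gramDet x y ≠ 0) :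
    ¬(x.1 0 0 = 0 ∧ x.1 0 1 = 0 ∧ x.1 1 0 = 0) := by
  rintro ⟨h1, h2, h3⟩
  apply h
  rw [gramDet, qnorm_eq x, pair_eq, h1, h2, h3]
  ring

lemma lower_left_ne_zero {x : TraceZero ℝ} (hx : 0 < qnorm x) : x.1 1 0 ≠ 0 := by
  intro h
  rw [qnorm_eq, h] at hx
  nlinarith [sq_nonneg (x.1 0 0)]

/-- A root of the polynomial `quad x`, for `x` of positive norm. -/
def root (x : TraceZero ℝ) : ℂ := ⟨x.1 0 0 / x.1 1 0, Real.sqrt (qnorm x) / x.1 1 0⟩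

lemma root_im_ne_zero {x : TraceZero ℝ} (hx : 0 < qnorm x) : (root x).im ≠ 0 :=
  div_ne_zero (Real.sqrt_pos.2 hx).ne' (lower_left_ne_zero hx)

lemma qnorm_eq_root {x : TraceZero ℝ} (hx : 0 < qnorm x) :
    qnorm x = (x.1 1 0) ^ 2 * (root x).im ^ 2 := by
  have hc := lower_left_ne_zero hx
  simp only [root, div_pow, Real.sq_sqrt hx.le]
  field_simp

lemma quad_eq_root {x : TraceZero ℝ} (hx : 0 < qnorm x) (z : ℂ) :
    quad x z = x.1 1 0 * ((z - root x) * (z - (starRingEnd ℂ) (root x))) := by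
  have hc := lower_left_ne_zero hx
  have h1 := qnorm_eq_root hx
  rw [qnorm_eq] at h1
  have h2 : x.1 1 0 * (root x).re = x.1 0 0 := by simp only [root]; field_simp
  have h3 : x.1 0 1 = -(x.1 1 0 * ((root x).re ^ 2 + (root x).im ^ 2)) := by
    refine mul_left_cancel₀ hc ?_
    rw [← h2] at h1
    linear_combination -h1
  rw [quad, h3, ← h2]
  apply Complex.ext <;> simp [pow_two] <;> ring

lemma height_eq_root {x : TraceZero ℝ} (hx : 0 < qnorm x) (z : ℂ) :
    height x z = x.1 1 0 ^ 2 * ‖z - root x‖ ^ 2 * ‖z - (starRingEnd ℂ) (root x)‖ ^ 2 /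
      (4 * z.im ^ 2) := by
  rw [height_eq_norm, quad_eq_root hx, norm_mul, norm_mul, Complex.norm_real, mul_pow, mul_pow,
    Real.norm_eq_abs, sq_abs, mul_assoc]

lemma im_sq_le_norm_sub_conj_sq {z α : ℂ} (h : 0 ≤ z.im * α.im) :
    z.im ^ 2 ≤ ‖z - (starRingEnd ℂ) α‖ ^ 2 := by
  rw [← Complex.normSq_eq_norm_sq, Complex.normSq_apply]
  simp only [Complex.sub_re, Complex.sub_im, Complex.conj_re, Complex.conj_im]
  nlinarith [sq_nonneg (z.re - α.re), sq_nonneg α.im]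

/-- Near the root in its half plane the height is bounded below quadratically. -/
lemma sq_mul_norm_sub_le_height {x : TraceZero ℝ} (hx : 0 < qnorm x) {α : ℂ}
    (hα : α = root x ∨ α = (starRingEnd ℂ) (root x)) {z : ℂ} (hz : 0 < z.im * α.im) :
    x.1 1 0 ^ 2 / 4 * ‖z - α‖ ^ 2 ≤ height x z := by
  have hz0 : z.im ≠ 0 := by rintro h; simp [h] at hz
  have h1 := im_sq_le_norm_sub_conj_sq hz.le
  have e : height x z = x.1 1 0 ^ 2 * ‖z - α‖ ^ 2 * ‖z - (starRingEnd ℂ) α‖ ^ 2 /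
      (4 * z.im ^ 2) := by
    rcases hα with rfl | rfl
    · exact height_eq_root hx z
    · rw [height_eq_root hx z, Complex.conj_conj]; ring
  rw [e, le_div_iff₀ (by positivity)]
  have := mul_le_mul_of_nonneg_left h1 (show 0 ≤ x.1 1 0 ^ 2 * ‖z - α‖ ^ 2 by positivity)
  linarith

/-- For negative norm, `R ≥ -Q > 0`. An isotropic vector has a double root on the real projective
line, so its height does decay towards a cusp, but no faster than the inverse of the gauge. -/
lemma le_height_mul_gauge {x : TraceZero ℝ} (hx : qnorm x ≤ 0)
    (h0 : ¬(x.1 0 0 = 0 ∧ x.1 0 1 = 0 ∧ x.1 1 0 = 0)) :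
    ∃ δ, 0 < δ ∧ ∀ z : ℂ, z.im ≠ 0 → δ ≤ height x z * gauge z := by
  rcases hx.lt_or_eq with hneg | hzero
  · refine ⟨-qnorm x, by linarith, fun z hz => ?_⟩
    have h1 := height_add_qnorm_nonneg x hz
    have h2 := four_le_gauge hz
    nlinarith
  · have hq := hzero
    rw [qnorm_eq] at hq
    -- The cusp is at infinity when the lower left entry vanishes, and is a finite real point
    -- otherwise.
    rcases eq_or_ne (x.1 1 0) 0 with hc | hc
    · have ha : x.1 0 0 = 0 := by
        rw [hc] at hq
        have : x.1 0 0 ^ 2 = 0 := by linarith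
        simpa using this
      have hb : x.1 0 1 ≠ 0 := fun hb => h0 ⟨ha, hb, hc⟩
      refine ⟨x.1 0 1 ^ 2 / 4, by positivity, fun z hz => ?_⟩
      rw [height_eq_rho, rho, ha, hc, gauge, div_mul_div_comm, div_le_div_iff₀ (by norm_num)
        (by positivity)]
      have h1 := im_sq_le z
      have h2 : (z.im ^ 2) ^ 2 ≤ (1 + ‖z‖ ^ 2) ^ 2 :=
        pow_le_pow_left₀ (sq_nonneg _) (by linarith) 2
      have h3 := mul_le_mul_of_nonneg_left h2 (sq_nonneg (x.1 0 1))
      nlinarith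
    · refine ⟨x.1 1 0 ^ 2 / 4, by positivity, fun z hz => ?_⟩
      have hv : 0 < z.im ^ 2 := by positivity
      have e : height x z = (((x.1 1 0 * z.re - x.1 0 0) ^ 2 + x.1 1 0 ^ 2 * z.im ^ 2) /
          (2 * x.1 1 0 * z.im)) ^ 2 := by
        rw [height_eq_lin x hz, hzero, lin, sub_zero]
        congr 1
        field_simp
        linear_combination hq
      have h1 : x.1 1 0 ^ 2 / 4 * z.im ^ 2 ≤ height x z := by
        rw [e, div_pow, le_div_iff₀ (by positivity)]
        have : (x.1 1 0 ^ 2 * z.im ^ 2) ^ 2 ≤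
            ((x.1 1 0 * z.re - x.1 0 0) ^ 2 + x.1 1 0 ^ 2 * z.im ^ 2) ^ 2 :=
          pow_le_pow_left₀ (by positivity) (by nlinarith [sq_nonneg (x.1 1 0 * z.re - x.1 0 0)]) 2
        linarith
      calc x.1 1 0 ^ 2 / 4 = x.1 1 0 ^ 2 / 4 * z.im ^ 2 * (z.im ^ 2)⁻¹ := by field_simp
        _ ≤ height x z * gauge z := by
          have := inv_sq_le_gauge hz
          have := height_nonneg x z
          gcongr

lemma height_pos_of_qnorm_nonpos {x : TraceZero ℝ} (hx : qnorm x ≤ 0)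
    (h0 : ¬(x.1 0 0 = 0 ∧ x.1 0 1 = 0 ∧ x.1 1 0 = 0)) {z : ℂ} (hz : z.im ≠ 0) :
    0 < height x z := by
  obtain ⟨δ, hδ, hb⟩ := le_height_mul_gauge hx h0
  have h1 := hb z hz
  have h2 := four_le_gauge hz
  by_contra h
  nlinarith

/-- The singularities of the inverse square root of the height are at most simple poles. -/
lemma inv_sqrt_height_le {x : TraceZero ℝ}
    (h0 : ¬(x.1 0 0 = 0 ∧ x.1 0 1 = 0 ∧ x.1 1 0 = 0)) :
    ∃ C : ℝ, ∃ α β : ℂ, 0 < C ∧ ∀ z : ℂ, z.im ≠ 0 →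
      (Real.sqrt (height x z))⁻¹ ≤ C * (gauge z + ‖z - α‖⁻¹ + ‖z - β‖⁻¹) := by
  rcases lt_or_ge 0 (qnorm x) with hx | hx
  · have hc := lower_left_ne_zero hx
    have hc' := abs_pos.2 hc
    refine ⟨2 / |x.1 1 0|, root x, (starRingEnd ℂ) (root x), by positivity, fun z hz => ?_⟩
    have h4 := four_le_gauge hz
    have key : ∀ α : ℂ, (α = root x ∨ α = (starRingEnd ℂ) (root x)) → 0 < z.im * α.im →
        (Real.sqrt (height x z))⁻¹ ≤ 2 / |x.1 1 0| * ‖z - α‖⁻¹ := by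
      intro α hα hzα
      have h1 := sq_mul_norm_sub_le_height hx hα hzα
      have e : x.1 1 0 ^ 2 / 4 * ‖z - α‖ ^ 2 = (|x.1 1 0| / 2 * ‖z - α‖) ^ 2 := by
        rw [mul_pow, div_pow, sq_abs]; norm_num
      have h2 : |x.1 1 0| / 2 * ‖z - α‖ ≤ Real.sqrt (height x z) := by
        rw [e] at h1
        exact Real.le_sqrt_of_sq_le h1
      -- At the root itself both sides are `0`, since `0⁻¹ = 0`.
      rcases eq_or_ne z α with rfl | hne
      · have : height x z = 0 := by
          rw [height_eq_root hx]
          rcases hα with h | h <;> simp [← h]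
        simp [this]
      · have hn : 0 < ‖z - α‖ := norm_pos_iff.2 (sub_ne_zero.2 hne)
        calc _ ≤ (|x.1 1 0| / 2 * ‖z - α‖)⁻¹ := by gcongr
          _ = _ := by rw [mul_inv, inv_div]
    have hq := root_im_ne_zero hx
    have hp1 : 0 ≤ ‖z - root x‖⁻¹ := by positivity
    have hp2 : 0 ≤ ‖z - (starRingEnd ℂ) (root x)‖⁻¹ := by positivity
    have hcc : 0 ≤ 2 / |x.1 1 0| := by positivity
    rcases lt_or_gt_of_ne (mul_ne_zero hz hq) with h | h
    · refine (key _ (Or.inr rfl) (by simp; linarith)).trans ?_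
      gcongr
      linarith
    · refine (key _ (Or.inl rfl) h).trans ?_
      gcongr
      linarith
  · obtain ⟨δ, hδ, hb⟩ := le_height_mul_gauge hx h0
    have hs : 0 < Real.sqrt δ := Real.sqrt_pos.2 hδ
    refine ⟨(Real.sqrt δ)⁻¹, 0, 0, by positivity, fun z hz => ?_⟩
    have h4 := four_le_gauge hz
    have hR := height_pos_of_qnorm_nonpos hx h0 hz
    have h1 : Real.sqrt δ ≤ Real.sqrt (height x z) * gauge z := by
      calc Real.sqrt δ ≤ Real.sqrt (height x z * gauge z) := Real.sqrt_le_sqrt (hb z hz)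
        _ = Real.sqrt (height x z) * Real.sqrt (gauge z) := Real.sqrt_mul hR.le _
        _ ≤ _ := by
          gcongr
          rw [Real.sqrt_le_left (by linarith)]
          nlinarith
    have hsR : 0 < Real.sqrt (height x z) := Real.sqrt_pos.2 hR
    have h2 : (Real.sqrt (height x z))⁻¹ ≤ (Real.sqrt δ)⁻¹ * gauge z := by
      rw [inv_mul_eq_div, le_div_iff₀ hs, inv_mul_le_iff₀ hsR]
      exact h1
    refine h2.trans ?_
    gcongr
    have : 0 ≤ ‖z - 0‖⁻¹ := by positivity
    linarith

/-- In polar coordinates the Jacobian `r` cancels the pole `r⁻¹`. -/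
lemma integrable_indicator_inv_norm (α : ℂ) :
    Integrable fun z : ℂ => Set.indicator (Set.Iio (1 : ℝ)) (fun r => r⁻¹) ‖z - α‖ := by
  have h : Integrable fun z : ℂ => Set.indicator (Set.Iio (1 : ℝ)) (fun r => r⁻¹) ‖z‖ := by
    rw [integrable_fun_norm_addHaar]
    have h1 : IntegrableOn (fun _ : ℝ => (1 : ℝ)) (Set.Ioo 0 1) := by simp
    have h2 : IntegrableOn (Set.indicator (Set.Iio (1 : ℝ)) fun _ => (1 : ℝ)) (Set.Ioi 0) := by
      rw [IntegrableOn, integrable_indicator_iff measurableSet_Iio, IntegrableOn,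
        Measure.restrict_restrict measurableSet_Iio]
      rwa [Set.inter_comm, Set.Ioi_inter_Iio]
    refine h2.congr_fun (fun r hr => ?_) measurableSet_Ioi
    have hr0 : r ≠ 0 := ne_of_gt hr
    simp only [Set.indicator_apply, Complex.finrank_real_complex]
    split_ifs <;> simp [hr0]
  exact h.comp_sub_right α

lemma integrable_exp_mul_inv_norm {κ : ℝ} (hκ : 0 < κ) (α : ℂ) :
    Integrable fun z : ℂ => Real.exp (-κ * ‖z‖ ^ 2) * ‖z - α‖⁻¹ := by
  refine Integrable.mono' ((integrable_indicator_inv_norm α).add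
    (integrable_exp_neg_norm_sq hκ)) ?_ (Eventually.of_forall fun z => ?_)
  · exact (by fun_prop : Measurable fun z : ℂ =>
      Real.exp (-κ * ‖z‖ ^ 2) * ‖z - α‖⁻¹).aestronglyMeasurable
  · rw [Real.norm_of_nonneg (by positivity)]
    have he : Real.exp (-κ * ‖z‖ ^ 2) ≤ 1 := Real.exp_le_one_iff.2 (by nlinarith [sq_nonneg ‖z‖])
    simp only [Pi.add_apply, Set.indicator_apply, Set.mem_Iio]
    have hn : 0 ≤ ‖z - α‖⁻¹ := by positivity
    split_ifs with h
    · nlinarith [Real.exp_pos (-κ * ‖z‖ ^ 2)]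
    · have : ‖z - α‖⁻¹ ≤ 1 := inv_le_one_of_one_le₀ (not_lt.1 h)
      rw [zero_add]
      exact mul_le_of_le_one_right (Real.exp_pos _).le this

/-- The dominating function for `ξ(y) ω(x)`, and for the second term of the truncated formula when
`y` has nonpositive norm. The exponent `π` instead of `2π` leaves room for the losses in bounding
`beta1` and `omega`. -/
lemma integrable_inv_sqrt_height_mul {x y : TraceZero ℝ} (h : gramDet x y ≠ 0) :
    Integrable fun z : ℂ => (Real.sqrt (height x z))⁻¹ *
      (gauge z ^ 2 * Real.exp (-(Real.pi * (height x z + height y z)))) := by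
  obtain ⟨C, α, β, hC, hb⟩ := inv_sqrt_height_le (coe_ne_zero_of_gramDet h)
  obtain ⟨σ, hσ0, hσ⟩ := gauge_le_height_add x y h
  have hκ : 0 < Real.pi * σ := by positivity
  obtain ⟨K, hK, hKb⟩ := gauge_pow_mul_exp_le 3 hκ
  have hκ2 : 0 < Real.pi * σ / 2 := by positivity
  refine Integrable.mono' ((((integrable_exp_neg_norm_sq hκ2).add
    (integrable_exp_mul_inv_norm hκ2 α)).add (integrable_exp_mul_inv_norm hκ2 β)).const_mul
    (C * K)) ?_ ?_
  · have hx := measurable_height x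
    have hy := measurable_height y
    have hs : Measurable fun z => Real.sqrt (height x z) := hx.sqrt
    unfold gauge
    exact (by fun_prop : Measurable fun z : ℂ => (Real.sqrt (height x z))⁻¹ *
      (((1 + ‖z‖ ^ 2) ^ 2 / z.im ^ 2) ^ 2 *
        Real.exp (-(Real.pi * (height x z + height y z))))).aestronglyMeasurable
  · filter_upwards [ae_im_ne_zero] with z hz
    have h4 := four_le_gauge hz
    have e1 : Real.exp (-(Real.pi * (height x z + height y z))) ≤
        Real.exp (-(Real.pi * σ * gauge z)) := by
      apply Real.exp_le_exp.2
      have := mul_le_mul_of_nonneg_left (hσ z) Real.pi_pos.le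
      linarith
    have hp1 : 0 ≤ ‖z - α‖⁻¹ := by positivity
    have hp2 : 0 ≤ ‖z - β‖⁻¹ := by positivity
    rw [Real.norm_of_nonneg (by positivity)]
    calc _ ≤ C * (gauge z + ‖z - α‖⁻¹ + ‖z - β‖⁻¹) *
          (gauge z ^ 2 * Real.exp (-(Real.pi * σ * gauge z))) := by
          gcongr
          exact hb z hz
      _ ≤ C * (gauge z * (1 + ‖z - α‖⁻¹ + ‖z - β‖⁻¹)) *
          (gauge z ^ 2 * Real.exp (-(Real.pi * σ * gauge z))) := by
          gcongr
          nlinarith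
      _ = C * (gauge z ^ 3 * Real.exp (-(Real.pi * σ * gauge z))) *
          (1 + ‖z - α‖⁻¹ + ‖z - β‖⁻¹) := by ring
      _ ≤ C * (K * Real.exp (-(Real.pi * σ / 2) * ‖z‖ ^ 2)) *
          (1 + ‖z - α‖⁻¹ + ‖z - β‖⁻¹) := by
          gcongr _ * ?_ * _
          exact hKb z hz
      _ = _ := by simp only [Pi.add_apply]; ring

lemma height_eq_zero_finite {x : TraceZero ℝ}
    (h0 : ¬(x.1 0 0 = 0 ∧ x.1 0 1 = 0 ∧ x.1 1 0 = 0)) :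
    {z : ℂ | z.im ≠ 0 ∧ height x z = 0}.Finite := by
  rcases lt_or_ge 0 (qnorm x) with hx | hx
  · refine Set.Finite.subset (Set.toFinite {root x, (starRingEnd ℂ) (root x)}) ?_
    rintro z ⟨hz, hz0⟩
    have hc := lower_left_ne_zero hx
    have h1 : quad x z = 0 := by
      by_contra h
      exact ((height_pos_iff x hz).2 h).ne' hz0
    rw [quad_eq_root hx] at h1
    rcases mul_eq_zero.1 h1 with h | h
    · exact absurd (Complex.ofReal_eq_zero.1 h) hc
    · rcases mul_eq_zero.1 h with h | h
      · exact Or.inl (sub_eq_zero.1 h)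
      · exact Or.inr (sub_eq_zero.1 h)
  · convert! Set.finite_empty
    rw [Set.eq_empty_iff_forall_notMem]
    rintro z ⟨hz, hz0⟩
    exact (height_pos_of_qnorm_nonpos hx h0 hz).ne' hz0

lemma ae_height_pos {x : TraceZero ℝ}
    (h0 : ¬(x.1 0 0 = 0 ∧ x.1 0 1 = 0 ∧ x.1 1 0 = 0)) : ∀ᵐ z : ℂ, 0 < height x z := by
  have h := (height_eq_zero_finite h0).measure_zero volume
  filter_upwards [ae_im_ne_zero, compl_mem_ae_iff.2 h] with z hz hz2
  refine lt_of_le_of_ne (height_nonneg x z) fun h => hz2 ⟨hz, h.symm⟩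

/-! ### The limit away from the divisor. -/

lemma xi_nonneg (x : TraceZero ℝ) (z : ℂ) : 0 ≤ xi x (point z) := beta1_nonneg _

lemma measurable_xi (x : TraceZero ℝ) : Measurable fun z => xi x (point z) :=
  measurable_beta1.comp ((measurable_height x).const_mul _)

lemma xi_le {x : TraceZero ℝ} {z : ℂ} (h : 0 < height x z) :
    xi x (point z) ≤
      4 * ((Real.sqrt (height x z))⁻¹ * Real.exp (-(Real.pi * height x z))) := by
  have hpi := Real.pi_gt_three
  rw [xi_point]
  refine (beta1_le_exp_div_sqrt (by positivity)).trans ?_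
  rw [show 2 * Real.pi * height x z / 2 = Real.pi * height x z by ring, mul_div_assoc,
    div_eq_inv_mul]
  gcongr
  nlinarith

lemma truncXi_le_xi {x : TraceZero ℝ} {z : ℂ} (h : 0 < height x z) {T : ℝ} (hT : 1 ≤ T) :
    truncXi x T z ≤ xi x (point z) :=
  truncBeta_le_beta1 (by positivity) hT

lemma tendsto_truncXi {x : TraceZero ℝ} {z : ℂ} (h : 0 < height x z) :
    Tendsto (fun T => truncXi x T z) atTop (𝓝 (xi x (point z))) :=
  tendsto_truncBeta (by positivity) tendsto_const_nhds tendsto_id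

lemma abs_xi_mul_omega_le {x y : TraceZero ℝ} : ∃ C, 0 < C ∧ ∀ z : ℂ, z.im ≠ 0 →
    0 < height y z → |xi y (point z) * omega x 1 z| ≤
      C * ((Real.sqrt (height y z))⁻¹ *
        (gauge z ^ 2 * Real.exp (-(Real.pi * (height y z + height x z))))) := by
  obtain ⟨C, hC, hb⟩ := abs_omega_le x
  refine ⟨4 * C, by positivity, fun z hz hy => ?_⟩
  have h4 := four_le_gauge hz
  have hx := height_nonneg x z
  have hg : gauss x 1 z ≤ Real.exp (-(Real.pi * height x z)) := by
    rw [gauss]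
    apply Real.exp_le_exp.2
    nlinarith [mul_nonneg Real.pi_pos.le hx]
  rw [abs_mul, abs_of_nonneg (xi_nonneg y z)]
  calc _ ≤ 4 * ((Real.sqrt (height y z))⁻¹ * Real.exp (-(Real.pi * height y z))) *
        (gauss x 1 z * (C * 1 * gauge z ^ 2)) :=
        mul_le_mul (xi_le hy) (hb 1 1 le_rfl le_rfl z hz) (abs_nonneg _) (by positivity)
    _ ≤ 4 * ((Real.sqrt (height y z))⁻¹ * Real.exp (-(Real.pi * height y z))) *
        (Real.exp (-(Real.pi * height x z)) * (C * 1 * gauge z ^ 2)) := by gcongr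
    _ = _ := by rw [mul_add, neg_add, Real.exp_add]; ring

lemma integrable_xi_mul_omega {x y : TraceZero ℝ} (h : gramDet x y ≠ 0) :
    Integrable fun z => xi y (point z) * omega x 1 z := by
  have h' : gramDet y x ≠ 0 := by rwa [gramDet_comm]
  obtain ⟨C, hC, hb⟩ := abs_xi_mul_omega_le (x := x) (y := y)
  refine Integrable.mono' ((integrable_inv_sqrt_height_mul h').const_mul C)
    ((measurable_xi y).mul (measurable_omega x 1)).aestronglyMeasurable ?_
  filter_upwards [ae_im_ne_zero, ae_height_pos (coe_ne_zero_of_gramDet h')] with z hz hy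
  exact hb z hz hy

lemma tendsto_integral_truncXi_mul_omega_one {x y : TraceZero ℝ} (h : gramDet x y ≠ 0) :
    Tendsto (fun T => ∫ z, truncXi y T z * omega x 1 z) atTop
      (𝓝 (∫ z, xi y (point z) * omega x 1 z)) := by
  have h' : gramDet y x ≠ 0 := by rwa [gramDet_comm]
  have hy := ae_height_pos (coe_ne_zero_of_gramDet h')
  refine tendsto_integral_filter_of_dominated_convergence
    (fun z => ‖xi y (point z) * omega x 1 z‖) ?_ ?_ (integrable_xi_mul_omega h).norm ?_
  · filter_upwards [eventually_ge_atTop 1] with T hT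
    exact (integrable_truncXi_mul_omega h' le_rfl hT).aestronglyMeasurable
  · filter_upwards [eventually_ge_atTop 1] with T hT
    filter_upwards [hy] with z hz
    rw [norm_mul, norm_mul, Real.norm_of_nonneg (truncXi_nonneg y hT z),
      Real.norm_of_nonneg (xi_nonneg y z)]
    gcongr
    exact truncXi_le_xi hz hT
  · filter_upwards [hy] with z hz
    exact (tendsto_truncXi hz).mul_const _

/-- Since `0 ≤ R + Q ≤ R`, half of the Gaussian exponent absorbs the factor linear in `T`. For
positive norm this fails, as that factor is of size `T` where `R` vanishes. -/
lemma abs_omega_le_of_nonpos {y : TraceZero ℝ} (hy : qnorm y ≤ 0) {T : ℝ} (hT : 1 ≤ T) {z : ℂ}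
    (hz : z.im ≠ 0) :
    |omega y T z| ≤ Real.exp (-(Real.pi * height y z) * T) * gauge z := by
  have hpi3 := Real.pi_gt_three
  have hR := height_nonneg y z
  have hl := height_add_qnorm_nonneg y hz
  have h4 := four_le_gauge hz
  have hpi : (2 * Real.pi)⁻¹ ≤ 1 := inv_le_one_of_one_le₀ (by linarith)
  have hpi0 : 0 ≤ (2 * Real.pi)⁻¹ := by positivity
  have hτ : 0 ≤ T * height y z := by positivity
  have h1 : |2 * T * (height y z + qnorm y) - (2 * Real.pi)⁻¹| ≤
      Real.exp (Real.pi * height y z * T) := by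
    have e := Real.add_one_le_exp (Real.pi * height y z * T)
    have a0 : 0 ≤ 2 * T * (height y z + qnorm y) := by positivity
    have a1 : 2 * T * (height y z + qnorm y) ≤ 2 * T * height y z := by
      gcongr; linarith
    rw [abs_le]
    constructor <;> nlinarith
  rw [omega, abs_div, abs_mul, abs_of_pos (gauss_pos y T z),
    abs_of_nonneg (sq_nonneg z.im), div_eq_mul_inv]
  calc _ ≤ gauss y T z * Real.exp (Real.pi * height y z * T) * gauge z := by
        have := inv_sq_le_gauge hz
        have := gauss_pos y T z
        gcongr
    _ = _ := by
        rw [gauss, ← Real.exp_add]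
        ring_nf

/-- The height of `y` has no zero in `D`, so the integrand decays pointwise in `T`; the case `T = 1`
of the bound dominates uniformly. -/
lemma tendsto_integral_truncXi_mul_omega_of_nonpos {x y : TraceZero ℝ} (h : gramDet x y ≠ 0)
    (hy : qnorm y ≤ 0) :
    Tendsto (fun T => ∫ z, truncXi x T z * omega y T z) atTop (𝓝 0) := by
  have h' : gramDet y x ≠ 0 := by rwa [gramDet_comm]
  have hx := ae_height_pos (coe_ne_zero_of_gramDet h)
  have key : ∀ T, 1 ≤ T → ∀ z : ℂ, z.im ≠ 0 → 0 < height x z →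
      |truncXi x T z * omega y T z| ≤
        xi x (point z) * gauge z * Real.exp (-(Real.pi * height y z) * T) := by
    intro T hT z hz hxz
    have h4 := four_le_gauge hz
    rw [abs_mul, abs_of_nonneg (truncXi_nonneg x hT z)]
    calc _ ≤ xi x (point z) * (Real.exp (-(Real.pi * height y z) * T) * gauge z) :=
          mul_le_mul (truncXi_le_xi hxz hT) (abs_omega_le_of_nonpos hy hT hz) (abs_nonneg _)
            (xi_nonneg x z)
      _ = _ := by ring
  rw [← integral_zero ℂ ℝ (μ := volume)]
  refine tendsto_integral_filter_of_dominated_convergence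
    (fun z => 4 * ((Real.sqrt (height x z))⁻¹ *
      (gauge z ^ 2 * Real.exp (-(Real.pi * (height x z + height y z)))))) ?_ ?_
    ((integrable_inv_sqrt_height_mul h).const_mul 4) ?_
  · filter_upwards [eventually_ge_atTop 1] with T hT
    exact (integrable_truncXi_mul_omega h hT hT).aestronglyMeasurable
  · filter_upwards [eventually_ge_atTop 1] with T hT
    filter_upwards [hx, ae_im_ne_zero] with z hxz hz
    have h4 := four_le_gauge hz
    have hR := height_nonneg y z
    calc _ ≤ _ := key T hT z hz hxz
      _ ≤ 4 * ((Real.sqrt (height x z))⁻¹ * Real.exp (-(Real.pi * height x z))) * gauge z ^ 2 *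
          Real.exp (-(Real.pi * height y z)) := by
          gcongr
          · exact xi_le hxz
          · nlinarith
          · nlinarith [mul_nonneg Real.pi_pos.le hR]
      _ = _ := by rw [mul_add, neg_add, Real.exp_add]; ring
  · filter_upwards [hx, ae_im_ne_zero] with z hxz hz
    have hyz := height_pos_of_qnorm_nonpos hy (coe_ne_zero_of_gramDet h') hz
    have ht : Tendsto (fun T : ℝ => Real.exp (-(Real.pi * height y z) * T)) atTop (𝓝 0) := by
      refine Real.tendsto_exp_atBot.comp ?_
      exact tendsto_id.const_mul_atTop_of_neg (by have := Real.pi_pos; nlinarith [mul_pos this hyz])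
    have ht2 := ht.const_mul (xi x (point z) * gauge z)
    rw [mul_zero] at ht2
    refine squeeze_zero_norm' ?_ ht2
    filter_upwards [eventually_ge_atTop 1] with T hT
    exact key T hT z hz hxz

/-! ### Concentration of mass at the points of the divisor. -/

/-- The connected component of `nonreal` containing `α`. -/
def halfPlane (α : ℂ) : Set ℂ := {z | 0 < z.im * α.im}

lemma isOpen_halfPlane (α : ℂ) : IsOpen (halfPlane α) :=
  isOpen_lt continuous_const (Complex.continuous_im.mul continuous_const)

/-- The height of `y` vanishes quadratically at a root, so `ω(√T y)` lives at distance `T ^ (-1/2)`;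
the Jacobian `T⁻¹` cancels its growth. -/
lemma setIntegral_halfPlane_rescale (α : ℂ) (F : ℂ → ℝ) {T : ℝ} (hT : 0 < T) :
    ∫ z in halfPlane α, F z =
      ∫ w : ℂ, T⁻¹ * (halfPlane α).indicator F (α + (Real.sqrt T)⁻¹ • w) := by
  rw [← integral_indicator (isOpen_halfPlane α).measurableSet, integral_const_mul,
    Measure.integral_comp_smul volume (fun w => (halfPlane α).indicator F (α + w)),
    integral_add_left_eq_self, Complex.finrank_real_complex, inv_pow, Real.sq_sqrt hT.le,
    inv_inv, abs_of_pos hT, smul_eq_mul, inv_mul_cancel_left₀ hT.ne']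

lemma height_root {y : TraceZero ℝ} (hy : 0 < qnorm y) {α : ℂ}
    (hα : α = root y ∨ α = (starRingEnd ℂ) (root y)) : height y α = 0 := by
  rw [height_eq_root hy]
  rcases hα with h | h <;> simp [← h]

lemma root_or_conj_im_ne_zero {y : TraceZero ℝ} (hy : 0 < qnorm y) {α : ℂ}
    (hα : α = root y ∨ α = (starRingEnd ℂ) (root y)) : α.im ≠ 0 := by
  have := root_im_ne_zero hy
  rcases hα with rfl | rfl
  · exact this
  · simpa using this

lemma height_pos_root {x y : TraceZero ℝ} (h : gramDet x y ≠ 0) {α : ℂ} (hα0 : α.im ≠ 0)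
    (hα : height y α = 0) : 0 < height x α := by
  obtain ⟨σ, hσ0, hσ⟩ := gauge_le_height_add x y h
  have h1 := hσ α
  have h2 := four_le_gauge hα0
  rw [hα, add_zero] at h1
  have : 0 < σ * gauge α := by positivity
  linarith

/-- A bound uniform in `T` after rescaling. Near `α` the height of `x` is bounded below. At distance
at least `r` the crude factor `T` is at most `‖w‖² / r²`, a polynomial that the Gaussian in `w` can
absorb. -/
lemma truncXi_le_near {x : TraceZero ℝ} {α : ℂ} (hα0 : α.im ≠ 0) (hα : 0 < height x α) :
    ∃ C r : ℝ, 0 < C ∧ 0 < r ∧ ∀ T : ℝ, 1 ≤ T → ∀ w : ℂ,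
      truncXi x T (α + (Real.sqrt T)⁻¹ • w) ≤
        gauss x 1 (α + (Real.sqrt T)⁻¹ • w) * (C + ‖w‖ ^ 2 / r ^ 2) := by
  obtain ⟨r, hr, hb⟩ := Metric.eventually_nhds_iff.1
    ((continuousAt_height x hα0).eventually (lt_mem_nhds (half_lt_self hα)))
  refine ⟨(2 * Real.pi * (height x α / 2))⁻¹, r, by positivity, hr, fun T hT w => ?_⟩
  set z := α + (Real.sqrt T)⁻¹ • w with hz
  have hT0 : 0 < T := by linarith
  have hg := gauss_pos x 1 z
  have hd : dist z α = (Real.sqrt T)⁻¹ * ‖w‖ := by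
    rw [hz, dist_eq_norm, add_sub_cancel_left, norm_smul, Real.norm_of_nonneg (by positivity)]
  rcases lt_or_ge (dist z α) r with hlt | hge
  · have h1 := hb hlt
    have hR : 0 < height x z := lt_trans (half_pos hα) h1
    calc truncXi x T z ≤ xi x (point z) := truncXi_le_xi hR hT
      _ ≤ Real.exp (-(2 * Real.pi * height x z)) / (2 * Real.pi * height x z) :=
          beta1_le_exp_div (by positivity)
      _ = gauss x 1 z * (2 * Real.pi * height x z)⁻¹ := by
          rw [gauss, mul_one, div_eq_mul_inv]
      _ ≤ gauss x 1 z * ((2 * Real.pi * (height x α / 2))⁻¹ + 0) := by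
          rw [add_zero]
          gcongr
      _ ≤ _ := by gcongr; positivity
  · refine (truncXi_le x hT z).trans ?_
    gcongr
    have h1 : r ^ 2 ≤ ((Real.sqrt T)⁻¹ * ‖w‖) ^ 2 := by
      rw [← hd]; gcongr
    rw [mul_pow, inv_pow, Real.sq_sqrt hT0.le] at h1
    have h2 : T ≤ ‖w‖ ^ 2 / r ^ 2 := by
      rw [le_div_iff₀ (by positivity)]
      have := mul_le_mul_of_nonneg_left h1 hT0.le
      rwa [mul_inv_cancel_left₀ hT0.ne'] at this
    have : 0 ≤ (2 * Real.pi * (height x α / 2))⁻¹ := by positivity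
    linarith

lemma integrable_add_sq_mul_exp (C D : ℝ) {κ : ℝ} (hκ : 0 < κ) :
    Integrable fun w : ℂ => (C + ‖w‖ ^ 2 * D) * Real.exp (-κ * ‖w‖ ^ 2) := by
  obtain ⟨K, hK, hb⟩ := pow_mul_exp_neg_le 1 (half_pos hκ)
  refine Integrable.mono' (((integrable_exp_neg_norm_sq hκ).const_mul |C|).add
    ((integrable_exp_neg_norm_sq (half_pos hκ)).const_mul (|D| * K))) ?_
    (Eventually.of_forall fun w => ?_)
  · exact (by fun_prop : Measurable fun w : ℂ =>
      (C + ‖w‖ ^ 2 * D) * Real.exp (-κ * ‖w‖ ^ 2)).aestronglyMeasurable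
  · have h1 := hb (‖w‖ ^ 2) (sq_nonneg _)
    rw [pow_one] at h1
    have e : Real.exp (-κ * ‖w‖ ^ 2) =
        Real.exp (-(κ / 2 * ‖w‖ ^ 2)) * Real.exp (-(κ / 2) * ‖w‖ ^ 2) := by
      rw [← Real.exp_add]; ring_nf
    rw [norm_mul, Real.norm_of_nonneg (Real.exp_pos _).le, Real.norm_eq_abs]
    calc _ ≤ (|C| + ‖w‖ ^ 2 * |D|) * Real.exp (-κ * ‖w‖ ^ 2) := by
          gcongr
          refine (abs_add_le _ _).trans (le_of_eq ?_)
          rw [abs_mul, abs_of_nonneg (sq_nonneg ‖w‖)]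
      _ = |C| * Real.exp (-κ * ‖w‖ ^ 2) + |D| * (‖w‖ ^ 2 *
            Real.exp (-(κ / 2 * ‖w‖ ^ 2))) * Real.exp (-(κ / 2) * ‖w‖ ^ 2) := by
          linear_combination ‖w‖ ^ 2 * |D| * e
      _ ≤ |C| * Real.exp (-κ * ‖w‖ ^ 2) + |D| * K * Real.exp (-(κ / 2) * ‖w‖ ^ 2) := by gcongr
      _ = _ := rfl

/-- The weight of `ω` blows up only at the boundary of `D`, where the two exponentials together
decay exponentially in the gauge. -/
lemma gauss_mul_weight_le {x y : TraceZero ℝ} (h : gramDet x y ≠ 0) :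
    ∃ K, 0 < K ∧ ∀ z : ℂ, z.im ≠ 0 →
      gauss x 1 z * Real.exp (-(Real.pi * height y z)) *
        ((2 * (height y z + qnorm y) + 1) / z.im ^ 2) ≤ K := by
  obtain ⟨σ, hσ0, hσ⟩ := gauge_le_height_add x y h
  obtain ⟨C, hC, -, hb⟩ := height_bounds y
  obtain ⟨K, hK, hKb⟩ := pow_mul_exp_neg_le 2 (show 0 < Real.pi * σ by positivity)
  refine ⟨(4 * C + 1) * K, by positivity, fun z hz => ?_⟩
  have h4 := four_le_gauge hz
  have hl := height_add_qnorm_nonneg y hz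
  have hx := height_nonneg x z
  have e1 : gauss x 1 z * Real.exp (-(Real.pi * height y z)) ≤
      Real.exp (-(Real.pi * σ * gauge z)) := by
    rw [gauss, ← Real.exp_add]
    apply Real.exp_le_exp.2
    have h1 := mul_le_mul_of_nonneg_left (hσ z) Real.pi_pos.le
    nlinarith [mul_nonneg Real.pi_pos.le hx]
  have e2 : 2 * (height y z + qnorm y) + 1 ≤ (4 * C + 1) * gauge z := by
    have := (hb z hz).2
    nlinarith
  calc _ ≤ Real.exp (-(Real.pi * σ * gauge z)) * ((4 * C + 1) * gauge z * gauge z) := by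
        rw [div_eq_mul_inv]
        have := inv_sq_le_gauge hz
        gcongr
    _ = (4 * C + 1) * (gauge z ^ 2 * Real.exp (-(Real.pi * σ * gauge z))) := by ring
    _ ≤ _ := by
      gcongr
      exact hKb _ (by linarith)

lemma inv_mul_omega (y : TraceZero ℝ) {T : ℝ} (hT : 0 < T) (z : ℂ) :
    T⁻¹ * omega y T z =
      gauss y T z * ((2 * (height y z + qnorm y) - (2 * Real.pi)⁻¹ * T⁻¹) / z.im ^ 2) := by
  rw [omega, mul_div_assoc, mul_left_comm, ← mul_div_assoc T⁻¹]
  congr 2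
  field_simp

/-- In the variable `w = √T (z - α)` the density of `ω(√T y)` tends to a Gaussian of total mass one,
while `ξ_T(x)` tends to its value at `α`. Each half plane contains exactly one of the two conjugate
roots. -/
lemma tendsto_setIntegral_halfPlane {x y : TraceZero ℝ} (h : gramDet x y ≠ 0)
    (hy : 0 < qnorm y) {α : ℂ} (hα : α = root y ∨ α = (starRingEnd ℂ) (root y)) :
    Tendsto (fun T => ∫ z in halfPlane α, truncXi x T z * omega y T z) atTop
      (𝓝 (xi x (point α))) := by
  have hα0 := root_or_conj_im_ne_zero hy hα
  have hRy := height_root hy hα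
  have hRx := height_pos_root h hα0 hRy
  have hc := lower_left_ne_zero hy
  set c := y.1 1 0 with hcdef
  have hpi := Real.pi_pos
  obtain ⟨C, r, hC, hr, hnear⟩ := truncXi_le_near hα0 hRx
  obtain ⟨K, hK, hKb⟩ := gauss_mul_weight_le h
  have hQ : qnorm y = c ^ 2 * α.im ^ 2 := by
    rw [qnorm_eq_root hy]
    rcases hα with rfl | rfl <;> simp [hcdef]
  -- The mass is `(2Q/(Im α)²) · π/(2πc²)`, which equals `1` because `Q = c² (Im α)²`.
  have hlim : ∫ w : ℂ, xi x (point α) *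
      (Real.exp (-(2 * Real.pi * c ^ 2) * ‖w‖ ^ 2) * ((2 * qnorm y) / α.im ^ 2)) =
      xi x (point α) := by
    rw [integral_const_mul, integral_mul_const,
      GaussianFourier.integral_rexp_neg_mul_sq_norm (by positivity), Complex.finrank_real_complex,
      hQ]
    norm_num
    field_simp
  rw [← hlim]
  have hrew : (fun T => ∫ z in halfPlane α, truncXi x T z * omega y T z) =ᶠ[atTop]
      fun T => ∫ w : ℂ, T⁻¹ * (halfPlane α).indicator (fun z => truncXi x T z * omega y T z)
        (α + (Real.sqrt T)⁻¹ • w) := by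
    filter_upwards [eventually_gt_atTop 0] with T hT
    exact setIntegral_halfPlane_rescale α _ hT
  refine Tendsto.congr' hrew.symm ?_
  refine tendsto_integral_filter_of_dominated_convergence
    (fun w => K * ((C + ‖w‖ ^ 2 * (r ^ 2)⁻¹) * Real.exp (-(Real.pi * c ^ 2 / 4) * ‖w‖ ^ 2)))
    ?_ ?_ ((integrable_add_sq_mul_exp C _ (by positivity)).const_mul K) ?_
  · filter_upwards [eventually_ge_atTop 1] with T hT
    have hm : Measurable ((halfPlane α).indicator fun z => truncXi x T z * omega y T z) :=
      ((measurable_truncXi x hT).mul (measurable_omega y T)).indicator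
        (isOpen_halfPlane α).measurableSet
    exact ((hm.comp (by fun_prop : Measurable fun w : ℂ =>
      α + (Real.sqrt T)⁻¹ • w)).const_mul T⁻¹).aestronglyMeasurable
  · filter_upwards [eventually_ge_atTop 1] with T hT
    refine Eventually.of_forall fun w => ?_
    have hT0 : 0 < T := by linarith
    have hn := hnear T hT w
    set z := α + (Real.sqrt T)⁻¹ • w with hz
    by_cases hzH : z ∈ halfPlane α
    swap
    · rw [Set.indicator_of_notMem hzH, mul_zero, norm_zero]
      positivity
    have hz0 : z.im ≠ 0 := fun h0 => by
      rw [halfPlane, Set.mem_ofPred_eq, h0, zero_mul] at hzH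
      exact lt_irrefl _ hzH
    rw [Set.indicator_of_mem hzH, mul_left_comm, inv_mul_omega y hT0, Real.norm_eq_abs, abs_mul,
      abs_of_nonneg (truncXi_nonneg x hT z), abs_mul, abs_of_pos (gauss_pos y T z), abs_div,
      abs_of_nonneg (sq_nonneg z.im)]
    have hR := height_nonneg y z
    have hl := height_add_qnorm_nonneg y hz0
    have b1 : |2 * (height y z + qnorm y) - (2 * Real.pi)⁻¹ * T⁻¹| ≤
        2 * (height y z + qnorm y) + 1 := by
      have i1 : (2 * Real.pi)⁻¹ * T⁻¹ ≤ 1 :=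
        mul_le_one₀ (inv_le_one_of_one_le₀ (by linarith [Real.pi_gt_three])) (by positivity)
          (inv_le_one_of_one_le₀ hT)
      have i2 : 0 ≤ (2 * Real.pi)⁻¹ * T⁻¹ := by positivity
      rw [abs_le]
      constructor <;> linarith
    -- Half of the exponent yields decay in `w` through the quadratic lower bound at the root; the
    -- other half is kept, with `T` replaced by `1`, for `gauss_mul_weight_le`.
    have b2 : gauss y T z ≤ Real.exp (-(Real.pi * height y z)) *
        Real.exp (-(Real.pi * c ^ 2 / 4) * ‖w‖ ^ 2) := by
      rw [gauss, ← Real.exp_add]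
      apply Real.exp_le_exp.2
      have i1 := sq_mul_norm_sub_le_height hy hα hzH
      have i2 : ‖z - α‖ ^ 2 = T⁻¹ * ‖w‖ ^ 2 := by
        rw [hz, add_sub_cancel_left, norm_smul, Real.norm_of_nonneg (by positivity), mul_pow,
          inv_pow, Real.sq_sqrt hT0.le]
      rw [i2] at i1
      have i3 : c ^ 2 / 4 * ‖w‖ ^ 2 ≤ height y z * T := by
        have := mul_le_mul_of_nonneg_right i1 hT0.le
        calc _ = c ^ 2 / 4 * (T⁻¹ * ‖w‖ ^ 2) * T := by field_simp
          _ ≤ _ := this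
      have i4 := mul_le_mul_of_nonneg_left i3 hpi.le
      have i5 := mul_le_mul_of_nonneg_left hT (mul_nonneg hpi.le hR)
      linarith
    have b3 := hKb z hz0
    calc _ ≤ gauss x 1 z * (C + ‖w‖ ^ 2 / r ^ 2) *
          ((Real.exp (-(Real.pi * height y z)) * Real.exp (-(Real.pi * c ^ 2 / 4) * ‖w‖ ^ 2)) *
            ((2 * (height y z + qnorm y) + 1) / z.im ^ 2)) := by
          have := gauss_pos x 1 z
          have := gauss_pos y T z
          have : 0 ≤ gauss y T z * (|2 * (height y z + qnorm y) - (2 * Real.pi)⁻¹ * T⁻¹| /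
            z.im ^ 2) := by positivity
          gcongr
      _ = gauss x 1 z * Real.exp (-(Real.pi * height y z)) *
          ((2 * (height y z + qnorm y) + 1) / z.im ^ 2) *
          ((C + ‖w‖ ^ 2 * (r ^ 2)⁻¹) * Real.exp (-(Real.pi * c ^ 2 / 4) * ‖w‖ ^ 2)) := by
          rw [div_eq_mul_inv (‖w‖ ^ 2)]; ring
      _ ≤ _ := by gcongr
  · refine Eventually.of_forall fun w => ?_
    have hε : Tendsto (fun T : ℝ => (Real.sqrt T)⁻¹) atTop (𝓝 0) :=
      Real.tendsto_sqrt_atTop.inv_tendsto_atTop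
    have hzt : Tendsto (fun T : ℝ => α + (Real.sqrt T)⁻¹ • w) atTop (𝓝 α) := by
      simpa using (hε.smul_const w).const_add α
    have hxt := tendsto_truncBeta (r₀ := 2 * Real.pi * height x α) (by positivity)
      ((((continuousAt_height x hα0).tendsto.comp hzt)).const_mul (2 * Real.pi)) tendsto_id
    have hyt := (continuousAt_height y hα0).tendsto.comp hzt
    have hvt := (Complex.continuous_im.tendsto α).comp hzt
    rw [hRy] at hyt
    have hnorm : ‖α - (starRingEnd ℂ) α‖ ^ 2 = 4 * α.im ^ 2 := by
      rw [← Complex.normSq_eq_norm_sq, Complex.normSq_apply]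
      simp
      ring
    -- This expression is `T · R(y,z)`, by the factorisation over the two roots; the factor from the
    -- conjugate root tends to `4 (Im α)²` and cancels the denominator.
    have hgt : Tendsto (fun T : ℝ => c ^ 2 * ‖w‖ ^ 2 *
        ‖α + (Real.sqrt T)⁻¹ • w - (starRingEnd ℂ) α‖ ^ 2 /
          (4 * (α + (Real.sqrt T)⁻¹ • w).im ^ 2)) atTop (𝓝 (c ^ 2 * ‖w‖ ^ 2)) := by
      have e : c ^ 2 * ‖w‖ ^ 2 = c ^ 2 * ‖w‖ ^ 2 * ‖α - (starRingEnd ℂ) α‖ ^ 2 /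
          (4 * α.im ^ 2) := by
        rw [hnorm]; field_simp
      nth_rewrite 2 [e]
      exact (((hzt.sub_const _).norm.pow 2).const_mul _).div ((hvt.pow 2).const_mul 4)
        (by positivity)
    have hexp := (Real.continuous_exp.tendsto _).comp (hgt.const_mul (-(2 * Real.pi)))
    have hwt := (((hyt.add_const (qnorm y)).const_mul 2).sub
      ((tendsto_inv_atTop_zero (𝕜 := ℝ)).const_mul ((2 * Real.pi)⁻¹))).div (hvt.pow 2)
      (by positivity)
    have hall := hxt.mul (hexp.mul hwt)
    rw [zero_add, mul_zero, sub_zero, ← mul_assoc (-(2 * Real.pi)), neg_mul] at hall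
    refine hall.congr' ?_
    filter_upwards [eventually_gt_atTop 0, hzt.eventually
      ((isOpen_halfPlane α).mem_nhds (show α ∈ halfPlane α from mul_self_pos.2 hα0))] with T hT hzH
    rw [Set.indicator_of_mem (show α + (Real.sqrt T)⁻¹ • w ∈ halfPlane α from hzH),
      mul_left_comm T⁻¹, inv_mul_omega y hT]
    set z := α + (Real.sqrt T)⁻¹ • w with hz
    have i2 : ‖z - α‖ ^ 2 = T⁻¹ * ‖w‖ ^ 2 := by
      rw [hz, add_sub_cancel_left, norm_smul, Real.norm_of_nonneg (by positivity), mul_pow,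
        inv_pow, Real.sq_sqrt hT.le]
    have i3 : height y z * T = c ^ 2 * ‖w‖ ^ 2 * ‖z - (starRingEnd ℂ) α‖ ^ 2 /
        (4 * z.im ^ 2) := by
      have e : height y z = c ^ 2 * ‖z - α‖ ^ 2 * ‖z - (starRingEnd ℂ) α‖ ^ 2 /
          (4 * z.im ^ 2) := by
        rcases hα with h1 | h1
        · rw [h1, height_eq_root hy]
        · rw [h1, height_eq_root hy, Complex.conj_conj]; ring
      rw [e, i2]
      field_simp
    simp only [Function.comp, Pi.div_apply, truncXi, gauss, id]
    rw [← hz, ← i3]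
    ring_nf

/-! ### Divisors and convergence of the star product. -/

lemma pair_rep_eq_zero_iff (x : TraceZero ℝ) (z : ℂ) :
    pair (toComplex x) (point z).rep = 0 ↔ quad x z = 0 := by
  obtain ⟨c, hc⟩ := Projectivization.exists_smul_eq_mk_rep ℂ (vec z) (vec_ne_zero z)
  have hc' : (c : ℂ) • vec z = (point z).rep := hc
  rw [← hc', pair_smul_right, pair_toComplex_vec, mul_eq_zero, or_iff_right c.ne_zero]

lemma divisor_eq_image (x : TraceZero ℝ) :
    divisor x = point '' {z : ℂ | z.im ≠ 0 ∧ height x z = 0} := by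
  have key : ∀ z : ℂ, z.im ≠ 0 → (quad x z = 0 ↔ height x z = 0) := fun z hz => by
    rw [← not_iff_not, ← ne_eq, ← height_pos_iff x hz, ← ne_eq, (height_nonneg x z).lt_iff_ne,
      ne_comm]
  ext p
  constructor
  · rintro ⟨hp, hp0⟩
    obtain ⟨z, hz, rfl⟩ := point_bijOn.surjOn hp
    exact ⟨z, ⟨hz, (key z hz).1 ((pair_rep_eq_zero_iff x z).1 hp0)⟩, rfl⟩
  · rintro ⟨z, ⟨hz, hz0⟩, rfl⟩
    exact ⟨point_bijOn.mapsTo hz, (pair_rep_eq_zero_iff x z).2 ((key z hz).2 hz0)⟩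

lemma divisor_finite {x y : TraceZero ℝ} (h : gramDet x y ≠ 0) : (divisor x).Finite := by
  rw [divisor_eq_image]
  exact (height_eq_zero_finite (coe_ne_zero_of_gramDet h)).image _

/-- A common point would make both heights vanish, against the lower bound of their sum by the
gauge. -/
lemma disjoint_divisor {x y : TraceZero ℝ} (h : gramDet x y ≠ 0) :
    Disjoint (divisor x) (divisor y) := by
  rw [divisor_eq_image, divisor_eq_image, Set.disjoint_left]
  rintro _ ⟨z, ⟨hz, hxz⟩, rfl⟩ ⟨w, ⟨hw, hyw⟩, hwz⟩
  obtain rfl := point_bijOn.injOn hw hz hwz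
  exact (height_pos_root h hz hyw).ne' hxz

lemma divisor_eq_empty {x : TraceZero ℝ} (hx : qnorm x ≤ 0)
    (h0 : ¬(x.1 0 0 = 0 ∧ x.1 0 1 = 0 ∧ x.1 1 0 = 0)) : divisor x = ∅ := by
  rw [divisor_eq_image, Set.image_eq_empty, Set.eq_empty_iff_forall_notMem]
  rintro z ⟨hz, hz0⟩
  exact (height_pos_of_qnorm_nonpos hx h0 hz).ne' hz0

lemma divisor_eq_pair {x : TraceZero ℝ} (hx : 0 < qnorm x) :
    divisor x = {point (root x), point ((starRingEnd ℂ) (root x))} := by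
  rw [divisor_eq_image, ← Set.image_pair]
  congr 1
  ext z
  simp only [Set.mem_ofPred_eq, Set.mem_insert_iff, Set.mem_singleton_iff]
  constructor
  · rintro ⟨hz, hz0⟩
    have h1 : quad x z = 0 := by
      by_contra h
      exact ((height_pos_iff x hz).2 h).ne' hz0
    rw [quad_eq_root hx, mul_eq_zero, mul_eq_zero, sub_eq_zero, sub_eq_zero] at h1
    exact h1.resolve_left fun h => lower_left_ne_zero hx (Complex.ofReal_eq_zero.1 h)
  · exact fun h => ⟨root_or_conj_im_ne_zero hx h, height_root hx h⟩

/-- The mass of `ω(√T y)` concentrates on the divisor of `y`. -/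
lemma tendsto_integral_truncXi_mul_omega {x y : TraceZero ℝ} (h : gramDet x y ≠ 0) :
    Tendsto (fun T => ∫ z, truncXi x T z * omega y T z) atTop
      (𝓝 (∑ᶠ p ∈ divisor y, xi x p)) := by
  have h' : gramDet y x ≠ 0 := by rwa [gramDet_comm]
  rcases lt_or_ge 0 (qnorm y) with hy | hy
  · have hα0 := root_im_ne_zero hy
    set α := root y with hα
    have hc0 : ((starRingEnd ℂ) α).im ≠ 0 := by simpa using hα0
    have hne : point α ≠ point ((starRingEnd ℂ) α) := by
      intro he
      have := congrArg Complex.im (point_bijOn.injOn hα0 hc0 he)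
      rw [Complex.conj_im] at this
      exact hα0 (by linarith)
    rw [divisor_eq_pair hy, finsum_mem_pair hne]
    refine Tendsto.congr' ?_ ((tendsto_setIntegral_halfPlane h hy (Or.inl rfl)).add
      (tendsto_setIntegral_halfPlane h hy (Or.inr rfl)))
    filter_upwards [eventually_ge_atTop 1] with T hT
    have hi := integrable_truncXi_mul_omega h hT hT
    have hd : Disjoint (halfPlane α) (halfPlane ((starRingEnd ℂ) α)) := by
      rw [Set.disjoint_left]
      intro z h1 h2
      simp only [halfPlane, Set.mem_ofPred_eq, Complex.conj_im] at h1 h2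
      linarith
    rw [← setIntegral_union hd (isOpen_halfPlane _).measurableSet hi.integrableOn
      hi.integrableOn]
    refine congrArg (fun μ => ∫ z, truncXi x T z * omega y T z ∂μ)
      (Measure.restrict_eq_self_of_ae_mem ?_)
    filter_upwards [ae_im_ne_zero] with z hz
    simp only [Set.mem_union, halfPlane, Set.mem_ofPred_eq, Complex.conj_im]
    rcases lt_or_gt_of_ne (mul_ne_zero hz hα0) with h1 | h1
    · right; linarith
    · left; exact h1
  · rw [divisor_eq_empty hy (coe_ne_zero_of_gramDet h')]
    simpa using tendsto_integral_truncXi_mul_omega_of_nonpos h hy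

lemma xi_mul_ddc_ae_eq {x y : TraceZero ℝ} (h : gramDet x y ≠ 0) :
    (fun z => xi y (point z) * ddc (xi x) z) =ᵐ[volume]
      fun z => xi y (point z) * omega x 1 z := by
  filter_upwards [ae_im_ne_zero, ae_height_pos (coe_ne_zero_of_gramDet h)] with z hz hx
  rw [ddc_xi x hz hx]

lemma starIntegrable_of_gramDet {x y : TraceZero ℝ} (h : gramDet x y ≠ 0) :
    StarIntegrable x y :=
  ⟨divisor_finite h, divisor_finite (by rwa [gramDet_comm] : gramDet y x ≠ 0),
    disjoint_divisor h,
    ((integrable_xi_mul_omega h).congr (xi_mul_ddc_ae_eq h).symm).integrableOn⟩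

lemma starIntegral_eq {x y : TraceZero ℝ} (h : gramDet x y ≠ 0) :
    starIntegral x y =
      (∑ᶠ p ∈ divisor y, xi x p) + ∫ z, xi y (point z) * omega x 1 z := by
  rw [starIntegral, starProduct, restrict_nonreal]
  simp only [one_mul]
  rw [integral_congr_ae (xi_mul_ddc_ae_eq h)]

/-! ### Invariance under the orthogonal group. -/

/-- The star product is the limit of integrals of a symmetric kernel. -/
lemma tendsto_integral_symKernel {x y : TraceZero ℝ} (h : gramDet x y ≠ 0) :
    Tendsto (fun T => ∫ z, ∫ t in (1 : ℝ)..T, symKernel x y t z) atTop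
      (𝓝 (starIntegral x y)) := by
  rw [starIntegral_eq h, add_comm]
  refine ((tendsto_integral_truncXi_mul_omega_one h).add
    (tendsto_integral_truncXi_mul_omega h)).congr' ?_
  filter_upwards [eventually_ge_atTop 1] with T hT
  exact integral_truncXi_add h hT

/-- The two Gaussians carry the same parameter `t`, so they multiply to one exponential and the two
weights add up: only the sums of heights and of norms survive. -/
lemma symKernel_eq (x y : TraceZero ℝ) (t : ℝ) (z : ℂ) :
    symKernel x y t z = Real.exp (-(2 * Real.pi * (height x z + height y z)) * t) *
      (2 * t * (height x z + height y z + (qnorm x + qnorm y)) - 2 * (2 * Real.pi)⁻¹) /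
        z.im ^ 2 * t⁻¹ := by
  have e : Real.exp (-(2 * Real.pi * (height x z + height y z)) * t) =
      gauss x t z * gauss y t z := by
    rw [gauss, gauss, ← Real.exp_add]; ring_nf
  rw [e, symKernel, omega, omega]
  ring

/-- Equal sums give equal kernels, and uniqueness of limits finishes; convergence of the untruncated
integral of the kernel is never needed. -/
lemma starIntegral_congr {x y x' y' : TraceZero ℝ} (h : gramDet x y ≠ 0)
    (h' : gramDet x' y' ≠ 0)
    (hR : ∀ z, height x' z + height y' z = height x z + height y z)
    (hQ : qnorm x' + qnorm y' = qnorm x + qnorm y) :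
    starIntegral x' y' = starIntegral x y := by
  have e : ∀ t z, symKernel x' y' t z = symKernel x y t z := fun t z => by
    rw [symKernel_eq, symKernel_eq, hR, hQ]
  have h1 := tendsto_integral_symKernel h'
  simp only [e] at h1
  exact tendsto_nhds_unique h1 (tendsto_integral_symKernel h)

/-- `R(·,z)` and `Q` are quadratic forms, and the sum of a quadratic form over a pair is preserved
when the rows `(p, q)` and `(r, s)` are orthonormal. The Gram determinant is multiplied by the
squared determinant, which is `1`. -/
lemma starIntegral_orthogonal {x y : TraceZero ℝ} (h : gramDet x y ≠ 0) {p q r s : ℝ}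
    (hpq : p ^ 2 + q ^ 2 = 1) (hrs : r ^ 2 + s ^ 2 = 1) (hpr : p * r + q * s = 0) :
    gramDet (p • x + r • y) (q • x + s • y) ≠ 0 ∧
      starIntegral (p • x + r • y) (q • x + s • y) = starIntegral x y := by
  have e : ∀ (a b : ℝ) (i j : Fin 2), (a • x + b • y).1 i j = a * x.1 i j + b * y.1 i j := by
    intro a b i j
    simp
  have hdet : (p * s - q * r) ^ 2 = 1 := by
    linear_combination (r ^ 2 + s ^ 2) * hpq + hrs - (p * r + q * s) * hpr
  have hG : gramDet (p • x + r • y) (q • x + s • y) = (p * s - q * r) ^ 2 * gramDet x y := by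
    simp only [gramDet, qnorm_eq, pair_eq, e]
    ring
  have hG0 : gramDet (p • x + r • y) (q • x + s • y) ≠ 0 := by
    rwa [hG, hdet, one_mul]
  refine ⟨hG0, starIntegral_congr h hG0 (fun z => ?_) ?_⟩
  · simp only [height_eq_rho, rho, e, ← add_div]
    congr 1
    set S₁ := x.1 1 0 * (z.re ^ 2 - z.im ^ 2) - 2 * x.1 0 0 * z.re - x.1 0 1 with hS₁
    set S₂ := y.1 1 0 * (z.re ^ 2 - z.im ^ 2) - 2 * y.1 0 0 * z.re - y.1 0 1 with hS₂
    set W₁ := 2 * x.1 1 0 * z.re * z.im - 2 * x.1 0 0 * z.im with hW₁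
    set W₂ := 2 * y.1 1 0 * z.re * z.im - 2 * y.1 0 0 * z.im with hW₂
    have a : ∀ a b : ℝ, ((a * x.1 1 0 + b * y.1 1 0) * (z.re ^ 2 - z.im ^ 2) -
        2 * (a * x.1 0 0 + b * y.1 0 0) * z.re - (a * x.1 0 1 + b * y.1 0 1)) =
        a * S₁ + b * S₂ := fun a b => by rw [hS₁, hS₂]; ring
    have b : ∀ a b : ℝ, (2 * (a * x.1 1 0 + b * y.1 1 0) * z.re * z.im -
        2 * (a * x.1 0 0 + b * y.1 0 0) * z.im) = a * W₁ + b * W₂ := fun a b => by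
      rw [hW₁, hW₂]; ring
    rw [a, a, b, b]
    linear_combination (S₁ ^ 2 + W₁ ^ 2) * hpq + (S₂ ^ 2 + W₂ ^ 2) * hrs +
      2 * (S₁ * S₂ + W₁ * W₂) * hpr
  · simp only [qnorm_eq, e]
    linear_combination (-x.1 0 0 ^ 2 - x.1 0 1 * x.1 1 0) * hpq +
      (-y.1 0 0 ^ 2 - y.1 0 1 * y.1 1 0) * hrs +
      (-2 * x.1 0 0 * y.1 0 0 - x.1 0 1 * y.1 1 0 - y.1 0 1 * x.1 1 0) * hpr

lemma toMat_rightAct {B : Type*} [Ring B] [Algebra ℚ B]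
    (φ : (ℝ ⊗[ℚ] B) ≃ₐ[ℝ] Matrix (Fin 2) (Fin 2) ℝ) (x : Fin 2 → VReal φ)
    (k : Matrix (Fin 2) (Fin 2) ℝ) (j : Fin 2) :
    toMat φ (rightAct x k j) = k 0 j • toMat φ (x 0) + k 1 j • toMat φ (x 1) := by
  apply Subtype.ext
  simp [toMat, rightAct, Fin.sum_univ_two]

lemma gram_det {B : Type*} [Ring B] [Algebra ℚ B]
    (φ : (ℝ ⊗[ℚ] B) ≃ₐ[ℝ] Matrix (Fin 2) (Fin 2) ℝ) (x : Fin 2 → VReal φ) :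
    (gram φ x).det = gramDet (toMat φ (x 0)) (toMat φ (x 1)) := by
  rw [Matrix.det_fin_two, gramDet, qnorm, qnorm, gram]
  simp only [Matrix.of_apply]
  rw [pair_eq (toMat φ (x 1)) (toMat φ (x 0)), pair_eq (toMat φ (x 0)) (toMat φ (x 1))]
  ring

end Shimura

end

theorem theorem3 {B : Type*} [Ring B] [Algebra ℚ B] [Algebra.IsCentral ℚ B] [IsSimpleRing B]
    (hB : Module.finrank ℚ B = 4)
    (φ : TensorProduct ℚ ℝ B ≃ₐ[ℝ] Matrix (Fin 2) (Fin 2) ℝ)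
    (x : Fin 2 → Shimura.VReal φ) (hx : (Shimura.gram φ x).det ≠ 0)
    (k : Matrix (Fin 2) (Fin 2) ℝ) (hk : k ∈ Matrix.orthogonalGroup (Fin 2) ℝ) :
    Shimura.LambdaConverges φ x ∧ Shimura.LambdaConverges φ (Shimura.rightAct x k) ∧
      Shimura.Lambda φ (Shimura.rightAct x k) = Shimura.Lambda φ x := by
  rw [Shimura.gram_det] at hx
  have hk1 := (Matrix.mem_orthogonalGroup_iff (Fin 2) ℝ).1 hk
  have e : ∀ i j, k i 0 * k j 0 + k i 1 * k j 1 = (1 : Matrix (Fin 2) (Fin 2) ℝ) i j := by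
    intro i j
    have := congrFun (congrFun hk1 i) j
    simpa [Matrix.mul_apply, Fin.sum_univ_two] using this
  have h00 : k 0 0 ^ 2 + k 0 1 ^ 2 = 1 := by simpa [pow_two] using e 0 0
  have h11 : k 1 0 ^ 2 + k 1 1 ^ 2 = 1 := by simpa [pow_two] using e 1 1
  have h01 : k 0 0 * k 1 0 + k 0 1 * k 1 1 = 0 := by simpa using e 0 1
  obtain ⟨h1, h2⟩ := Shimura.starIntegral_orthogonal hx h00 h11 h01
  rw [Shimura.LambdaConverges, Shimura.LambdaConverges, Shimura.Lambda, Shimura.Lambda,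
    Shimura.toMat_rightAct, Shimura.toMat_rightAct]
  exact ⟨Shimura.starIntegrable_of_gramDet hx, Shimura.starIntegrable_of_gramDet h1, h2⟩
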